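/- Let $\mathcal M$ be a von Neumann algebra on a Hilbert space that is generated, as a von Neumann algebra, by finitely many elements, and let $\tau$ be a normal tracial state on $\mathcal M$. Suppose that $\mathcal M$ is hyperfinite, i.e. generated as a von Neumann algebra by an upward directed family (for instance an increasing sequence) of finite-dimensional $*$-subalgebras. Notation. For $k\ge 1$ let $\tau_k=\frac1k\mathrm{Tr}$ on the $k\times k$ complex matrices $\mathcal M_k(\mathbb C)$, and put $\|(A_1,\dots,A_n)\|_2=\big(\sum_j\tau_k(A_j^*A_j)\big)^{1/2}$ on $\mathcal M_k(\mathbb C)^n$. For $x_1,\dots,x_n\in\mathcal M$, $R,\epsilon>0$ and $m,k\in\mathbb N$, let $\Gamma_R(x_1,\dots,x_n;m,k,\epsilon)$ be the set of $(A_1,\dots,A_n)\in\mathcal M_k(\mathbb C)^n$ with operator norms $\|A_j\|\le R$ and $$|\tau_k(A_{i_1}^{\eta_1}\cdots A_{i_q}^{\eta_q})-\tau(x_{i_1}^{\eta_1}\cdots x_{i_q}^{\eta_q})|<\epsilon$$ for all $1\le q\le m$, $1\le i_1,\dots,i_q\le n$ and $\eta_1,\dots,\eta_q\in\{1,*\}$.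 The $\omega$-orbit-ball centered at $(B_1,\dots,B_n)$ is the set of $(A_1,\dots,A_n)$ with $\|(A_1-WB_1W^*,\dots,A_n-WB_nW^*)\|_2<\omega$ for some unitary $k\times k$ matrix $W$. For a set $\Gamma\subset\mathcal M_k(\mathbb C)^n$, $\nu(\Gamma,\omega)$ is the minimal number of $\omega$-orbit-balls with centers in $\Gamma$ that cover $\Gamma$. Put $$\mathfrak K_2(x_1,\dots,x_n)=\sup_{0<\omega<1}\ \sup_{R>0}\ \inf_{m\in\mathbb N,\,\epsilon>0}\ \limsup_{k\to\infty}\frac{\log\nu(\Gamma_R(x_1,\dots,x_n;m,k,\epsilon),\omega)}{-k^2\log\omega}$$ (in $[-\infty,\infty]$, with $\log 0=-\infty$), and let $\mathfrak K_2(\mathcal M)$ be the supremum of $\mathfrak K_2(x_1,\dots,x_n)$ over all finite families $x_1,\dots,x_n$ that generate $\mathcal M$ as a von Neumann algebra. Theorem. $\mathfrak K_2(\mathcal M)=0$. Moreover, for every finite family $x_1,\dots,x_n$ that generates $\mathcal M$ as a von Neumann algebra and all $R>0$ and $\omega>0$, there are $m_0\in\mathbb N$ and $\epsilon_0>0$ such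 that, for all $m\ge m_0$ and $0<\epsilon\le\epsilon_0$: $\nu(\Gamma_R(x_1,\dots,x_n;m,k,\epsilon),\omega)\le 1$ for every $k\ge1$, i.e. the microstate space is empty or covered by a single $\omega$-orbit-ball centered in it; and, if $R>\max_j\|x_j\|$, then $\nu(\Gamma_R(x_1,\dots,x_n;m,k,\epsilon),\omega)=1$ for all sufficiently large $k$. -/

import Mathlib

open Filter Topology

noncomputable section

namespace FreeOrbit

/-! ### Tuples of matrices -/

/-- The normalized trace `τ_k = (1/k) Tr` on `k × k` complex matrices. -/
def normTrace {k : ℕ} (A : Matrix (Fin k) (Fin k) ℂ) : ℂ :=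
  (k : ℂ)⁻¹ * A.trace

/-- The operator norm of a `k × k` complex matrix acting on the Hilbert space `ℂ^k`. -/
def opNorm {k : ℕ} (A : Matrix (Fin k) (Fin k) ℂ) : ℝ :=
  ‖Matrix.toEuclideanCLM (n := Fin k) (𝕜 := ℂ) A‖

/-- The trace norm on `n`-tuples: `‖(A₁,…,Aₙ)‖₂² = ∑ⱼ τ_k(Aⱼ* Aⱼ)`. -/
def norm2 {n k : ℕ} (A : Fin n → Matrix (Fin k) (Fin k) ℂ) : ℝ :=
  Real.sqrt (∑ j, (normTrace (star (A j) * A j)).re)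

/-- The `ω`-orbit-ball centered at `B`: the tuples at `‖·‖₂`-distance less than `ω` from
`(W B₁ W*, …, W Bₙ W*)` for some unitary matrix `W`. -/
def orbitBall {n k : ℕ} (B : Fin n → Matrix (Fin k) (Fin k) ℂ) (ω : ℝ) :
    Set (Fin n → Matrix (Fin k) (Fin k) ℂ) :=
  {A | ∃ W ∈ Matrix.unitaryGroup (Fin k) ℂ, norm2 (fun j => A j - W * B j * star W) < ω}

/-- The `ω`-orbit covering number of `Γ`: the minimal number of `ω`-orbit-balls with centers in `Γ`
that cover `Γ`. -/
def orbitCoveringNumber {n k : ℕ} (Γ : Set (Fin n → Matrix (Fin k) (Fin k) ℂ)) (ω : ℝ) : ℕ∞ :=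
  ⨅ (C : Set (Fin n → Matrix (Fin k) (Fin k) ℂ)) (_ : C ⊆ Γ) (_ : Γ ⊆ ⋃ B ∈ C, orbitBall B ω),
    C.encard

/-- The `*`-word `x_{i₁}^{η₁} ⋯ x_{i_q}^{η_q}`, where a letter `(i, true)` stands for `x_i*` and
`(i, false)` for `x_i`. -/
def starWord {A : Type*} [Monoid A] [Star A] {n : ℕ} (x : Fin n → A)
    (w : List (Fin n × Bool)) : A :=
  (w.map fun p => if p.2 then star (x p.1) else x p.1).prod

/-! ### Von Neumann algebras -/

variable {H : Type*} [NormedAddCommGroup H] [InnerProductSpace ℂ H] [CompleteSpace H]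

/-- `M` is the von Neumann algebra generated by the set `S` of operators, that is, the smallest
von Neumann algebra containing `S`. -/
def IsGeneratedBySet (M : VonNeumannAlgebra H) (S : Set (H →L[ℂ] H)) : Prop :=
  S ⊆ (M : Set (H →L[ℂ] H)) ∧
    ∀ N : VonNeumannAlgebra H, S ⊆ (N : Set (H →L[ℂ] H)) →
      (M : Set (H →L[ℂ] H)) ⊆ (N : Set (H →L[ℂ] H))

/-- `x₁,…,xₙ` generate `M` as a von Neumann algebra. -/
def Generates (M : VonNeumannAlgebra H) {n : ℕ} (x : Fin n → M.toStarSubalgebra) : Prop :=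
  IsGeneratedBySet M (Set.range fun j => (x j : H →L[ℂ] H))

/-- `M` is generated by finitely many elements as a von Neumann algebra. -/
def IsFinitelyGenerated (M : VonNeumannAlgebra H) : Prop :=
  ∃ (n : ℕ) (x : Fin n → M.toStarSubalgebra), Generates M x

/-- `M` is hyperfinite: it is generated by an upward directed family (for instance an increasing
sequence) of finite-dimensional `*`-subalgebras. -/
def IsHyperfinite (M : VonNeumannAlgebra H) : Prop :=
  ∃ 𝓕 : Set (StarSubalgebra ℂ (H →L[ℂ] H)),
    𝓕.Nonempty ∧ DirectedOn (· ≤ ·) 𝓕 ∧ (∀ F ∈ 𝓕, FiniteDimensional ℂ F) ∧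
      IsGeneratedBySet M (⋃ F ∈ 𝓕, (F : Set (H →L[ℂ] H)))

open scoped ComplexOrder in
/-- `τ` is a normal (that is, ultraweakly continuous) tracial state on `M`. -/
structure IsNormalTracialState (M : VonNeumannAlgebra H) (τ : M.toStarSubalgebra →ₗ[ℂ] ℂ) :
    Prop where
  map_one : τ 1 = 1
  nonneg : ∀ a, 0 ≤ τ (star a * a)
  trace : ∀ a b, τ (a * b) = τ (b * a)
  normal : ∃ ξ η : ℕ → H, (Summable fun i => ‖ξ i‖ ^ 2) ∧ (Summable fun i => ‖η i‖ ^ 2) ∧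
    ∀ a : M.toStarSubalgebra, HasSum (fun i => inner ℂ (η i) ((a : H →L[ℂ] H) (ξ i))) (τ a)

/-- The microstate space `Γ_R(x₁,…,xₙ; m, k, ε)`. -/
def microstates {M : VonNeumannAlgebra H} (τ : M.toStarSubalgebra →ₗ[ℂ] ℂ) {n : ℕ}
    (x : Fin n → M.toStarSubalgebra) (R : ℝ) (m k : ℕ) (ε : ℝ) :
    Set (Fin n → Matrix (Fin k) (Fin k) ℂ) :=
  {A | (∀ j, opNorm (A j) ≤ R) ∧
    ∀ w : List (Fin n × Bool), 1 ≤ w.length → w.length ≤ m →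
      ‖normTrace (starWord A w) - τ (starWord x w)‖ < ε}

/-- `𝔎(x₁,…,xₙ; ω, R)`, the infimum over `m` and `ε > 0` of
`limsup_k log ν(Γ_R(x₁,…,xₙ; m, k, ε), ω) / (-k² log ω)`, an extended real (with `log 0 = -∞`). -/
def orbitDimAtR {M : VonNeumannAlgebra H} (τ : M.toStarSubalgebra →ₗ[ℂ] ℂ) {n : ℕ}
    (x : Fin n → M.toStarSubalgebra) (ω R : ℝ) : EReal :=
  ⨅ (m : ℕ) (ε : ℝ) (_ : 0 < ε),
    limsup (fun k : ℕ =>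
      ENNReal.log (orbitCoveringNumber (microstates τ x R m k ε) ω : ENNReal) /
        ((-(k : ℝ) ^ 2 * Real.log ω : ℝ) : EReal)) atTop

/-- `𝔎(x₁,…,xₙ; ω) = sup_{R > 0} 𝔎(x₁,…,xₙ; ω, R)`. -/
def orbitDimAt {M : VonNeumannAlgebra H} (τ : M.toStarSubalgebra →ₗ[ℂ] ℂ) {n : ℕ}
    (x : Fin n → M.toStarSubalgebra) (ω : ℝ) : EReal :=
  ⨆ (R : ℝ) (_ : 0 < R), orbitDimAtR τ x ω R

/-- The upper free orbit-dimension `𝔎₂(x₁,…,xₙ) = sup_{0 < ω < 1} 𝔎(x₁,…,xₙ; ω)`. -/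
def upperOrbitDimTuple {M : VonNeumannAlgebra H} (τ : M.toStarSubalgebra →ₗ[ℂ] ℂ) {n : ℕ}
    (x : Fin n → M.toStarSubalgebra) : EReal :=
  ⨆ ω ∈ Set.Ioo (0 : ℝ) 1, orbitDimAt τ x ω

/-- The upper free orbit-dimension `𝔎₂(M)` of a finitely generated von Neumann algebra, the supremum
of `𝔎₂(x₁,…,xₙ)` over all finite families of generators. -/
def upperOrbitDim (M : VonNeumannAlgebra H) (τ : M.toStarSubalgebra →ₗ[ℂ] ℂ) : EReal :=
  ⨆ (n : ℕ) (x : Fin n → M.toStarSubalgebra) (_ : Generates M x), upperOrbitDimTuple τ x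

end FreeOrbit

end

/-!
If two tuples of microstates of generators of a hyperfinite `M` are accurate enough, they are almost
conjugate by a unitary. The reason is that both approximately carry the matrix units of one
finite-dimensional subalgebra `F` of `M` which almost contains the generators, and that systems of
matrix units in `M_k(ℂ)` with almost equal traces are almost conjugate, uniformly in `k`.

*Density.* By von Neumann's double commutant argument, applied to an amplification that carries the
normal trace as a vector functional, a generating `*`-algebra is dense in `M` for `‖·‖₂`
(`IsNormalTracialState.dense`). Hence `F` exists (`IsHyperfinite.exists_finiteDimensional`), and the
words in the generators are dense too.

*Transport of matrix units.* The matrix units of `F` are written as `v_i v_j*` for a system of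
partial isometries `v_i` (`IsColumnSystem`). Given microstates of increasing accuracy, let `𝒜` be
the C*-algebra generated by the tuple of families whose `j`-th member consists of the `j`-th
generator and the `j`-th entries of all those microstates. It maps onto a
`‖·‖₂`-dense subalgebra of `M` and to each of the matrix algebras, and the normalized traces converge
pointwise on it to the trace of `M` (`exists_limit_model`). The `v_i` are approximated by images of
contractions of `𝒜`: here Kaplansky's density theorem is proved with the truncation
`d ↦ 2 d (1 + d* d)⁻¹`, which is rational, hence commutes with `*`-homomorphisms, has values in the
unit ball, and is Lipschitz for `‖·‖₂` (`IsTracialState.exists_norm_le_one`). Images of those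
contractions in the matrix algebras satisfy the relations of a column system approximately.

*Conjugation.* Let `V_i` and `U_i` be approximate column systems in `M_k(ℂ)` whose minimal projections
have almost equal traces. A unitary carries each minimal projection of the second system near the
corresponding one of the first; with such unitaries `W`, the intertwiner `∑ V_i W_{r i} U_i*` is
almost isometric and almost intertwines `V_i V_j*` with `U_i U_j*`, so its polar part solves the
problem (`exists_mem_orbitBall`). Together with a compactness argument by contradiction, this gives
`exists_forall_mem_orbitBall`.

*Existence.* The finite-dimensional algebra `F` has (non-unital) representations on `ℂ^k` with block
multiplicities `⌊k τ(v_{r i})⌋`, whose normalized traces converge to `τ`. The truncation turns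
approximants in `F` of the generators into approximants with the same norm bound, whose images are
microstates (`eventually_nonempty_microstates`).

So the covering number of a good microstate space is at most one, and equal to one for large `k` if
the cutoff exceeds the norms of the generators. Its logarithm is then `≤ 0`, respectively `0`, and
the orbit dimension vanishes.
-/

open Filter Topology

noncomputable section

namespace FreeOrbit

open scoped ComplexOrder Matrix.Norms.L2Operator

/-! ### The trace seminorm of a tracial state -/

/-- `τ` is a tracial state on the `*`-algebra `A` (no normality is asked for). -/
structure IsTracialState {A : Type*} [Ring A] [StarRing A] [Algebra ℂ A] (τ : A →ₗ[ℂ] ℂ) :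
    Prop where
  map_one : τ 1 = 1
  nonneg : ∀ a, 0 ≤ τ (star a * a)
  trace : ∀ a b, τ (a * b) = τ (b * a)

/-- The seminorm `‖a‖₂ = τ(a* a)^{1/2}` of a positive functional. -/
def twoNorm {A : Type*} [Ring A] [StarRing A] [Algebra ℂ A] (τ : A →ₗ[ℂ] ℂ) (a : A) : ℝ :=
  √(τ (star a * a)).re

section TwoNorm

variable {A : Type*} [CStarAlgebra A] {τ : A →ₗ[ℂ] ℂ}

lemma twoNorm_nonneg (τ : A →ₗ[ℂ] ℂ) (a : A) : 0 ≤ twoNorm τ a := Real.sqrt_nonneg _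

lemma twoNorm_zero (τ : A →ₗ[ℂ] ℂ) : twoNorm τ 0 = 0 := by simp [twoNorm]

/-- The seminorm and the sesquilinear form of a tracial state are those of its
pre-GNS space; this collects the consequences used below. -/
lemma IsTracialState.gns (hτ : IsTracialState τ) :
    (∀ a b, twoNorm τ (a + b) ≤ twoNorm τ a + twoNorm τ b) ∧
    (∀ (c : ℂ) a, twoNorm τ (c • a) = ‖c‖ * twoNorm τ a) ∧
    (∀ a b, twoNorm τ (a * b) ≤ ‖a‖ * twoNorm τ b) ∧
    (∀ a b, ‖τ (star a * b)‖ ≤ twoNorm τ a * twoNorm τ b) := by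
  let := CStarAlgebra.spectralOrder A
  have := CStarAlgebra.spectralOrderedRing A
  have hpos : ∀ a, 0 ≤ a → 0 ≤ τ a := by
    intro a ha
    obtain ⟨b, rfl⟩ := CStarAlgebra.nonneg_iff_eq_star_mul_self.1 ha
    exact hτ.nonneg b
  let f : A →ₚ[ℂ] ℂ := PositiveLinearMap.mk₀ τ hpos
  refine ⟨fun a b => ?_, fun c a => ?_, fun a b => ?_, fun a b => ?_⟩
  · exact norm_add_le (f.toPreGNS a) (f.toPreGNS b)
  · exact norm_smul c (f.toPreGNS a)
  · exact ((f.leftMulMapPreGNS a).le_opNorm (f.toPreGNS b)).trans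
      (mul_le_mul_of_nonneg_right
        (LinearMap.mkContinuous_norm_le _ (norm_nonneg a) _) (norm_nonneg _))
  · exact norm_inner_le_norm (𝕜 := ℂ) (f.toPreGNS a) (f.toPreGNS b)

lemma IsTracialState.add_le (hτ : IsTracialState τ) (a b : A) :
    twoNorm τ (a + b) ≤ twoNorm τ a + twoNorm τ b := hτ.gns.1 a b

lemma IsTracialState.smul (hτ : IsTracialState τ) (c : ℂ) (a : A) :
    twoNorm τ (c • a) = ‖c‖ * twoNorm τ a := hτ.gns.2.1 c a

lemma IsTracialState.mul_le_left (hτ : IsTracialState τ) (a b : A) :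
    twoNorm τ (a * b) ≤ ‖a‖ * twoNorm τ b := hτ.gns.2.2.1 a b

lemma IsTracialState.cauchy_schwarz (hτ : IsTracialState τ) (a b : A) :
    ‖τ (star a * b)‖ ≤ twoNorm τ a * twoNorm τ b := hτ.gns.2.2.2 a b

lemma IsTracialState.twoNorm_star (hτ : IsTracialState τ) (a : A) :
    twoNorm τ (star a) = twoNorm τ a := by
  simp only [twoNorm, star_star, hτ.trace a]

lemma IsTracialState.mul_le_right (hτ : IsTracialState τ) (a b : A) :
    twoNorm τ (a * b) ≤ twoNorm τ a * ‖b‖ := by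
  rw [← hτ.twoNorm_star, star_mul, mul_comm, ← hτ.twoNorm_star a, ← norm_star b]
  exact hτ.mul_le_left _ _

lemma IsTracialState.neg (hτ : IsTracialState τ) (a : A) :
    twoNorm τ (-a) = twoNorm τ a := by
  simpa using hτ.smul (-1) a

lemma IsTracialState.sub_comm (hτ : IsTracialState τ) (a b : A) :
    twoNorm τ (a - b) = twoNorm τ (b - a) := by
  rw [← hτ.neg, neg_sub]

lemma IsTracialState.sub_le (hτ : IsTracialState τ) (a b : A) :
    twoNorm τ (a - b) ≤ twoNorm τ a + twoNorm τ b := by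
  rw [sub_eq_add_neg, ← hτ.neg b]; exact hτ.add_le _ _

lemma IsTracialState.triangle (hτ : IsTracialState τ) (a b c : A) :
    twoNorm τ (a - c) ≤ twoNorm τ (a - b) + twoNorm τ (b - c) := by
  simpa using hτ.add_le (a - b) (b - c)

lemma IsTracialState.sum_le (hτ : IsTracialState τ) {ι : Type*} (s : Finset ι) (f : ι → A) :
    twoNorm τ (∑ i ∈ s, f i) ≤ ∑ i ∈ s, twoNorm τ (f i) :=
  Finset.le_sum_of_subadditive (twoNorm τ) (twoNorm_zero τ).le hτ.add_le s f

lemma IsTracialState.twoNorm_one (hτ : IsTracialState τ) : twoNorm τ 1 = 1 := by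
  simp [twoNorm, hτ.map_one]

lemma IsTracialState.norm_le (hτ : IsTracialState τ) (a : A) : ‖τ a‖ ≤ twoNorm τ a := by
  simpa [hτ.twoNorm_one] using hτ.cauchy_schwarz 1 a

lemma IsTracialState.twoNorm_le (hτ : IsTracialState τ) (a : A) : twoNorm τ a ≤ ‖a‖ := by
  simpa [hτ.twoNorm_one] using hτ.mul_le_left a 1

lemma IsTracialState.norm_le_norm (hτ : IsTracialState τ) (a : A) : ‖τ a‖ ≤ ‖a‖ :=
  (hτ.norm_le a).trans (hτ.twoNorm_le a)

lemma IsTracialState.mul_mul_le (hτ : IsTracialState τ) (a b c : A) :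
    twoNorm τ (a * b * c) ≤ ‖a‖ * twoNorm τ b * ‖c‖ :=
  (hτ.mul_le_right _ _).trans (mul_le_mul_of_nonneg_right (hτ.mul_le_left _ _) (norm_nonneg _))

/-- Multiplication by a contraction on each side does not increase `‖·‖₂`. -/
lemma IsTracialState.conj_le (hτ : IsTracialState τ) {a c : A} (b : A) (ha : ‖a‖ ≤ 1)
    (hc : ‖c‖ ≤ 1) : twoNorm τ (a * b * c) ≤ twoNorm τ b := by
  refine (hτ.mul_mul_le a b c).trans ?_
  have h := twoNorm_nonneg τ b
  calc ‖a‖ * twoNorm τ b * ‖c‖ ≤ 1 * twoNorm τ b * 1 := by gcongr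
    _ = _ := by ring

lemma IsTracialState.sq_twoNorm (hτ : IsTracialState τ) (a : A) :
    ((twoNorm τ a ^ 2 : ℝ) : ℂ) = τ (star a * a) := by
  have h := hτ.nonneg a
  rw [twoNorm, Real.sq_sqrt h.1]
  exact Complex.ext rfl h.2

end TwoNorm

/-- The pull-back of a tracial state under a unital `*`-homomorphism. -/
lemma IsTracialState.comp {A B : Type*} [Ring A] [StarRing A] [Algebra ℂ A] [Ring B] [StarRing B]
    [Algebra ℂ B] {τ : A →ₗ[ℂ] ℂ} (hτ : IsTracialState τ) (φ : B →⋆ₐ[ℂ] A) :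
    IsTracialState (τ ∘ₗ (φ : B →ₐ[ℂ] A).toLinearMap) where
  map_one := by simp [hτ.map_one]
  nonneg a := by simpa [map_star] using hτ.nonneg (φ a)
  trace a b := by simpa using hτ.trace (φ a) (φ b)

/-- The normalized trace as a linear functional. -/
def matTrace (k : ℕ) : Matrix (Fin k) (Fin k) ℂ →ₗ[ℂ] ℂ where
  toFun := normTrace
  map_add' A B := by simp [normTrace, Matrix.trace_add, mul_add]
  map_smul' c A := by simp [normTrace, Matrix.trace_smul]; ring

lemma matTrace_apply {k : ℕ} (A : Matrix (Fin k) (Fin k) ℂ) : matTrace k A = normTrace A := rfl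

lemma isTracialState_matTrace {k : ℕ} (hk : 1 ≤ k) : IsTracialState (matTrace k) where
  map_one := by
    have : (k : ℂ) ≠ 0 := by exact_mod_cast (by omega : k ≠ 0)
    simp [matTrace_apply, normTrace, this]
  nonneg A := by
    rw [matTrace_apply, normTrace]
    have h1 : (0 : ℂ) ≤ (k : ℂ)⁻¹ := by
      rw [← Complex.ofReal_natCast, ← Complex.ofReal_inv]
      exact_mod_cast (by positivity : (0 : ℝ) ≤ (k : ℝ)⁻¹)
    exact mul_nonneg h1 (Matrix.PosSemidef.trace_nonneg (Matrix.posSemidef_conjTranspose_mul_self A))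
  trace A B := by simp [matTrace_apply, normTrace, Matrix.trace_mul_comm A B]

/-! ### A smooth truncation onto the unit ball -/

/-- The truncation `g(d) = 2 d (1 + d* d)⁻¹`, Kaplansky's map of an algebra into its unit ball. -/
def truncate {A : Type*} [Ring A] [StarRing A] [Algebra ℂ A] (d : A) : A :=
  (2 : ℂ) • (d * Ring.inverse (1 + star d * d))

section Truncate

variable {A : Type*} [CStarAlgebra A]

lemma ringInverse_eq {B : Type*} [Ring B] {u w : B} (h1 : u * w = 1) (h2 : w * u = 1) :
    Ring.inverse u = w :=
  Ring.inverse_unit ⟨u, w, h1, h2⟩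

lemma isUnit_one_add_of_exists_star {b : A} (h : ∃ d, b = star d * d) : IsUnit (1 + b) := by
  let := CStarAlgebra.spectralOrder A
  have := CStarAlgebra.spectralOrderedRing A
  have hb : 0 ≤ b := CStarAlgebra.nonneg_iff_eq_star_mul_self.2 h
  exact CStarAlgebra.isUnit_of_le 1 (by simpa using hb)

lemma norm_le_one_of_eq_sum_sq {a b c : A} (h : 1 - star a * a = star b * b + star c * c) :
    ‖a‖ ≤ 1 := by
  let := CStarAlgebra.spectralOrder A
  have := CStarAlgebra.spectralOrderedRing A
  have h1 : star a * a ≤ 1 := by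
    rw [← sub_nonneg, h]
    exact add_nonneg (star_mul_self_nonneg b) (star_mul_self_nonneg c)
  have h2 : ‖star a * a‖ ≤ 1 :=
    (CStarAlgebra.norm_le_one_iff_of_nonneg _ (star_mul_self_nonneg a)).2 h1
  rw [CStarRing.norm_star_mul_self] at h2
  nlinarith [norm_nonneg a]

/-- The inverse of `1 + d* d`, a self-adjoint contraction. -/
lemma exists_inverse (d : A) : ∃ w : A, (1 + star d * d) * w = 1 ∧ w * (1 + star d * d) = 1 ∧
    star w = w ∧ ‖w‖ ≤ 1 ∧ truncate d = (2 : ℂ) • (d * w) ∧ ‖d * w‖ ≤ 1 / 2 := by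
  obtain ⟨u, hu⟩ := isUnit_one_add_of_exists_star (b := star d * d) ⟨d, rfl⟩
  set w : A := ((u⁻¹ : Aˣ) : A) with hw
  have h1 : (1 + star d * d) * w = 1 := by rw [← hu]; simp [hw]
  have h2 : w * (1 + star d * d) = 1 := by rw [← hu]; simp [hw]
  have h3 : star w = w := by
    have h4 : star w * (1 + star d * d) = 1 := by
      have := congrArg star h1
      simpa using this
    calc star w = star w * ((1 + star d * d) * w) := by rw [h1, mul_one]
      _ = w := by rw [← mul_assoc, h4, one_mul]
  have key : w * ((1 + star d * d) * (1 + star d * d)) * w = 1 := by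
    rw [← mul_assoc, h2, one_mul, h1]
  refine ⟨w, h1, h2, h3, ?_, by rw [truncate, ringInverse_eq h1 h2], ?_⟩
  · refine norm_le_one_of_eq_sum_sq (b := (√2 : ℂ) • (d * w)) (c := star d * d * w) ?_
    have h5 : (√2 : ℂ) * (√2 : ℂ) = 2 := by
      rw [← Complex.ofReal_mul, Real.mul_self_sqrt (by norm_num)]; norm_num
    simp only [star_smul, star_mul, star_star, smul_mul_assoc, mul_smul_comm, smul_smul, h3,
      Complex.star_def, Complex.conj_ofReal, h5]
    nth_rewrite 1 [← key]
    rw [two_smul]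
    noncomm_ring
  · have : ‖(2 : ℂ) • (d * w)‖ ≤ 1 := by
      refine norm_le_one_of_eq_sum_sq (b := (1 - star d * d) * w) (c := 0) ?_
      simp only [star_smul, star_mul, star_star, smul_mul_assoc, mul_smul_comm, smul_smul, h3,
        star_sub, star_one, star_zero, mul_zero, add_zero, RCLike.star_def, map_ofNat]
      nth_rewrite 1 [← key]
      norm_num [← Nat.cast_smul_eq_nsmul ℂ]
      rw [show (4 : ℂ) = ((4 : ℕ) : ℂ) by norm_num, Nat.cast_smul_eq_nsmul]
      noncomm_ring
    rw [norm_smul] at this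
    norm_num at this
    linarith

lemma norm_truncate_le (d : A) : ‖truncate d‖ ≤ 1 := by
  obtain ⟨w, -, -, -, -, h, h'⟩ := exists_inverse d
  rw [h, norm_smul]
  norm_num
  linarith

lemma map_truncate {B : Type*} [Ring B] [StarRing B] [Algebra ℂ B] (φ : A →⋆ₐ[ℂ] B) (d : A) :
    φ (truncate d) = truncate (φ d) := by
  obtain ⟨w, h1, h2, -, -, h, -⟩ := exists_inverse d
  have h1' := congrArg φ h1
  have h2' := congrArg φ h2
  simp only [map_mul, map_add, map_one, map_star] at h1' h2'
  rw [h, truncate, ringInverse_eq h1' h2', map_smul, map_mul]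

/-- The truncation is Lipschitz for `‖·‖₂`, by a resolvent identity. -/
lemma IsTracialState.truncate_sub_le {τ : A →ₗ[ℂ] ℂ} (hτ : IsTracialState τ) (y d : A) :
    twoNorm τ (truncate y - truncate d) ≤ 3 * twoNorm τ (y - d) := by
  obtain ⟨r, hr1, hr2, -, -, hy, hy'⟩ := exists_inverse y
  obtain ⟨r', hs1, hs2, -, hn, -, -⟩ := exists_inverse (star y)
  obtain ⟨s, h1, h2, -, hsn, hd, hd'⟩ := exists_inverse d
  rw [star_star] at hs1 hs2
  have hc : y * r = r' * y := by
    calc y * r = (r' * (1 + y * star y)) * (y * r) := by rw [hs2, one_mul]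
      _ = r' * y * ((1 + star y * y) * r) := by noncomm_ring
      _ = r' * y := by rw [hr1, mul_one]
  have hid : truncate y - truncate d =
      (2 : ℂ) • (r' * (y - d) * s) + (2 : ℂ) • ((y * r) * star (d - y) * (d * s)) := by
    rw [hy, hd, ← smul_sub, ← smul_add, hc]
    congr 1
    calc r' * y - d * s = r' * y * ((1 + star d * d) * s) - (r' * (1 + y * star y)) * (d * s) := by
          rw [h1, hs2, mul_one, one_mul]
      _ = _ := by rw [star_sub]; noncomm_ring
  have e1 : twoNorm τ (r' * (y - d) * s) ≤ twoNorm τ (y - d) := hτ.conj_le _ hn hsn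
  have e2 : twoNorm τ ((y * r) * star (d - y) * (d * s)) ≤ 1 / 4 * twoNorm τ (y - d) := by
    refine (hτ.mul_mul_le _ _ _).trans ?_
    rw [hτ.twoNorm_star, hτ.sub_comm d y]
    have := twoNorm_nonneg τ (y - d)
    calc ‖y * r‖ * twoNorm τ (y - d) * ‖d * s‖ ≤ 1 / 2 * twoNorm τ (y - d) * (1 / 2) := by gcongr
      _ = _ := by ring
  rw [hid]
  refine (hτ.add_le _ _).trans ?_
  rw [hτ.smul, hτ.smul, show ‖(2 : ℂ)‖ = 2 by norm_num]
  linarith [twoNorm_nonneg τ (y - d)]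

/-- Every contraction is a truncation. -/
lemma exists_truncate_eq {x : A} (hx : ‖x‖ ≤ 1) : ∃ y : A, truncate y = x := by
  let := CStarAlgebra.spectralOrder A
  have := CStarAlgebra.spectralOrderedRing A
  have hle : star x * x ≤ 1 := by
    rw [← CStarAlgebra.norm_le_one_iff_of_nonneg _ (star_mul_self_nonneg x),
      CStarRing.norm_star_mul_self]
    nlinarith [norm_nonneg x]
  have h0 : 0 ≤ 1 - star x * x := sub_nonneg.2 hle
  set s := CFC.sqrt (1 - star x * x) with hs
  have hss : s * s = 1 - star x * x := CFC.sqrt_mul_sqrt_self _ h0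
  have hs0 : 0 ≤ s := CFC.sqrt_nonneg _
  obtain ⟨u, hu⟩ := isUnit_one_add_of_exists_star (CStarAlgebra.nonneg_iff_eq_star_mul_self.1 hs0)
  set t : A := ((u⁻¹ : Aˣ) : A) with ht
  have h1 : (1 + s) * t = 1 := by rw [← hu]; simp [ht]
  have h2 : t * (1 + s) = 1 := by rw [← hu]; simp [ht]
  have hst : star s = s := (IsSelfAdjoint.of_nonneg hs0).star_eq
  have h3 : star t = t := by
    have h4 : star t * (1 + s) = 1 := by
      have := congrArg star h1
      simpa [hst] using this
    calc star t = star t * ((1 + s) * t) := by rw [h1, mul_one]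
      _ = t := by rw [← mul_assoc, h4, one_mul]
  have h5 : 1 + star (x * t) * (x * t) = (2 : ℂ) • t := by
    have hxx : star x * x = 1 - s * s := by rw [hss]; abel
    calc 1 + star (x * t) * (x * t) = (1 + s) * t + t * (star x * x) * t := by
          rw [h1, star_mul, h3]; noncomm_ring
      _ = (1 + s) * t + (t * (1 + s)) * (1 - s) * t := by rw [hxx]; noncomm_ring
      _ = (2 : ℂ) • t := by rw [h2, two_smul]; noncomm_ring
  refine ⟨x * t, ?_⟩
  have h6 : Ring.inverse (1 + star (x * t) * (x * t)) = (1 / 2 : ℂ) • (1 + s) := by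
    rw [h5]
    apply ringInverse_eq
    · rw [smul_mul_smul_comm, h2]; norm_num
    · rw [smul_mul_smul_comm, h1]; norm_num
  rw [truncate, h6, mul_smul_comm, smul_smul, mul_assoc, h2]
  norm_num

/-- Kaplansky's density theorem for `‖·‖₂`: if the image of a `*`-homomorphism `φ` is
`‖·‖₂`-dense at every point, then contractions are approximated by images of contractions. -/
lemma IsTracialState.exists_norm_le_one {B : Type*} [CStarAlgebra B] {τ : A →ₗ[ℂ] ℂ}
    (hτ : IsTracialState τ) (φ : B →⋆ₐ[ℂ] A)
    (hφ : ∀ a : A, ∀ δ > 0, ∃ b : B, twoNorm τ (φ b - a) < δ) {x : A} (hx : ‖x‖ ≤ 1)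
    {δ : ℝ} (hδ : 0 < δ) : ∃ b : B, ‖b‖ ≤ 1 ∧ twoNorm τ (φ b - x) < δ := by
  obtain ⟨y, rfl⟩ := exists_truncate_eq hx
  obtain ⟨b, hb⟩ := hφ y (δ / 3) (by positivity)
  refine ⟨truncate b, norm_truncate_le b, ?_⟩
  rw [map_truncate]
  linarith [hτ.truncate_sub_le (φ b) y]

end Truncate

/-! ### Density of a generating `*`-algebra in the trace seminorm -/

section Amplification

variable {H : Type*} [NormedAddCommGroup H] [InnerProductSpace ℂ H]

/-- The diagonal action `(ζ_i) ↦ (T ζ_i)` of an operator on `⨁_ι H`. -/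
def amplify (ι : Type*) (T : H →L[ℂ] H) :
    lp (fun _ : ι => H) 2 →L[ℂ] lp (fun _ : ι => H) 2 :=
  LinearMap.mkContinuous
    { toFun := fun ζ => ⟨fun i => T (ζ i), by
        refine memℓp_gen ?_
        have h := (lp.memℓp ζ).summable (by norm_num)
        refine Summable.of_nonneg_of_le (fun i => by positivity) (fun i => ?_)
          (h.mul_left (‖T‖ ^ (2 : ENNReal).toReal))
        rw [← Real.mul_rpow (norm_nonneg _) (norm_nonneg _)]
        exact Real.rpow_le_rpow (norm_nonneg _) (T.le_opNorm _) (by norm_num)⟩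
      map_add' := fun ζ η => by ext i; exact map_add T _ _
      map_smul' := fun c ζ => by ext i; simp }
    ‖T‖ (fun ζ => by
      refine (lp.norm_mono (y := ((‖T‖ : ℝ) : ℂ) • ζ) (by norm_num) (fun i => ?_)).trans
        (by rw [norm_smul, Complex.norm_real, norm_norm])
      rw [lp.coeFn_smul, Pi.smul_apply, norm_smul, Complex.norm_real, norm_norm]
      exact T.le_opNorm (ζ i))

@[simp]
lemma amplify_apply {ι : Type*} (T : H →L[ℂ] H) (ζ : lp (fun _ : ι => H) 2) (i : ι) :
    amplify ι T ζ i = T (ζ i) := rfl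

/-- Half of von Neumann's density theorem, amplified: an operator in the double commutant of a
unital `*`-algebra `D` is approximated by elements of `D` on a square-summable family of vectors. -/
lemma exists_norm_amplify_sub_lt [CompleteSpace H] (D : StarSubalgebra ℂ (H →L[ℂ] H))
    {a : H →L[ℂ] H} (ha : a ∈ Set.centralizer (Set.centralizer (D : Set (H →L[ℂ] H))))
    {ι : Type*} (ζ : lp (fun _ : ι => H) 2) {δ : ℝ} (hδ : 0 < δ) :
    ∃ d ∈ D, ‖amplify ι d ζ - amplify ι a ζ‖ < δ := by
  classical
  let ev : (H →L[ℂ] H) →ₗ[ℂ] lp (fun _ : ι => H) 2 :=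
    { toFun := fun T => amplify ι T ζ
      map_add' := fun S T => by ext i; simp
      map_smul' := fun c T => by ext i; simp }
  let S : Submodule ℂ (lp (fun _ : ι => H) 2) :=
    (Subalgebra.toSubmodule D.toSubalgebra).map ev
  let K := S.topologicalClosure
  have hKc : IsClosed (K : Set (lp (fun _ : ι => H) 2)) := S.isClosed_topologicalClosure
  have : CompleteSpace K := hKc.completeSpace_coe
  -- `K` is invariant under `D`, hence its projection `P` commutes with `D`.
  have hinv : ∀ d ∈ D, ∀ k ∈ K, amplify ι d k ∈ K := by
    intro d hd k hk
    refine map_mem_closure (amplify ι d).continuous hk ?_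
    rintro _ ⟨e, he, rfl⟩
    refine ⟨d * e, D.mul_mem hd he, ?_⟩
    ext i; rfl
  have hadj : ∀ (d : H →L[ℂ] H) (x y : lp (fun _ : ι => H) 2),
      inner ℂ x (amplify ι d y) = inner ℂ (amplify ι (star d) x) y := by
    intro d x y
    refine (lp.hasSum_inner x (amplify ι d y)).unique ?_
    convert lp.hasSum_inner (𝕜 := ℂ) (amplify ι (star d) x) y using 2 with i
    exact (ContinuousLinearMap.adjoint_inner_left d _ _).symm
  let P := K.starProjection
  have hcomm : ∀ d ∈ D, ∀ x, P (amplify ι d x) = amplify ι d (P x) := by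
    intro d hd x
    refine Submodule.eq_starProjection_of_mem_orthogonal
      (hinv d hd _ (Submodule.starProjection_apply_mem K x)) ?_
    rw [← map_sub, Submodule.mem_orthogonal]
    intro k hk
    rw [hadj]
    exact (Submodule.mem_orthogonal K _).1 (Submodule.sub_starProjection_mem_orthogonal x) _
      (hinv _ (star_mem hd) k hk)
  -- The matrix entries of `P` lie in the commutant of `D`, so `P` commutes with `a` too.
  let Q : ι → ι → H →L[ℂ] H := fun i j =>
    (lp.evalCLM ℂ (fun _ : ι => H) 2 i) ∘L P ∘L (lp.singleContinuousLinearMap ℂ (fun _ : ι => H) 2 j)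
  have hsingle : ∀ (T : H →L[ℂ] H) (j : ι) (h : H), amplify ι T (lp.single 2 j h) =
      lp.single 2 j (T h) := by
    intro T j h
    ext i
    by_cases hij : i = j
    · subst hij; simp
    · simp [hij]
  have hQ : ∀ i j, Q i j ∈ Set.centralizer (D : Set (H →L[ℂ] H)) := by
    intro i j d hd
    ext h
    change d (P (lp.single 2 j h) i) = P (lp.single 2 j (d h)) i
    rw [← hsingle, hcomm d hd]
    rfl
  have hPa : P ∘L amplify ι a = amplify ι a ∘L P := by
    refine lp.ext_continuousLinearMap (by norm_num) fun j => ?_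
    ext h i
    change P (amplify ι a (lp.single 2 j h)) i = a (P (lp.single 2 j h) i)
    rw [hsingle]
    exact DFunLike.congr_fun (ha (Q i j) (hQ i j)) h
  have hζ : ζ ∈ K := S.le_topologicalClosure ⟨1, D.one_mem, by ext i; rfl⟩
  have haζ : amplify ι a ζ ∈ K := by
    have h1 := DFunLike.congr_fun hPa ζ
    change P (amplify ι a ζ) = amplify ι a (P ζ) at h1
    have h2 : P ζ = ζ := Submodule.starProjection_eq_self_iff.2 hζ
    rw [h2] at h1
    exact Submodule.starProjection_eq_self_iff.1 h1
  obtain ⟨_, ⟨d, hd, rfl⟩, hlt⟩ := Metric.mem_closure_iff.1 haζ δ hδ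
  refine ⟨d, hd, ?_⟩
  rw [dist_comm, dist_eq_norm] at hlt
  exact hlt

end Amplification

section Density

variable {H : Type*} [NormedAddCommGroup H] [InnerProductSpace ℂ H] [CompleteSpace H]

/-- A von Neumann algebra is norm-closed, being a commutant; with this, Mathlib makes it a
C*-algebra. -/
scoped instance (M : VonNeumannAlgebra H) :
    IsClosed ((M.toStarSubalgebra : StarSubalgebra ℂ (H →L[ℂ] H)) : Set (H →L[ℂ] H)) := by
  rw [VonNeumannAlgebra.coe_toStarSubalgebra, ← M.centralizer_centralizer]
  exact Set.isClosed_centralizer _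

lemma IsNormalTracialState.isTracialState {M : VonNeumannAlgebra H}
    {τ : M.toStarSubalgebra →ₗ[ℂ] ℂ} (hτ : IsNormalTracialState M τ) : IsTracialState τ :=
  ⟨hτ.map_one, hτ.nonneg, hτ.trace⟩

lemma IsGeneratedBySet.subset_bicommutant {M : VonNeumannAlgebra H} {S : Set (H →L[ℂ] H)}
    (hS : IsGeneratedBySet M S) (D : StarSubalgebra ℂ (H →L[ℂ] H)) (hD : S ⊆ D) :
    (M : Set (H →L[ℂ] H)) ⊆ Set.centralizer (Set.centralizer (D : Set (H →L[ℂ] H))) := by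
  have hstar : (D : Set (H →L[ℂ] H)) ∪ star (D : Set (H →L[ℂ] H)) = D := by
    refine Set.union_eq_self_of_subset_right fun x hx => ?_
    simpa using star_mem (S := StarSubalgebra ℂ (H →L[ℂ] H)) hx
  let N : VonNeumannAlgebra H :=
    { toStarSubalgebra :=
        StarSubalgebra.centralizer ℂ (StarSubalgebra.centralizer ℂ (D : Set (H →L[ℂ] H)))
      centralizer_centralizer' := by
        change Set.centralizer (Set.centralizer ((StarSubalgebra.centralizer ℂ
          (StarSubalgebra.centralizer ℂ (D : Set (H →L[ℂ] H)) : Set (H →L[ℂ] H)) :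
          StarSubalgebra ℂ (H →L[ℂ] H)) : Set (H →L[ℂ] H))) = ((StarSubalgebra.centralizer ℂ
          (StarSubalgebra.centralizer ℂ (D : Set (H →L[ℂ] H)) : Set (H →L[ℂ] H)) :
          StarSubalgebra ℂ (H →L[ℂ] H)) : Set (H →L[ℂ] H))
        rw [StarSubalgebra.coe_centralizer_centralizer, Set.centralizer_centralizer_centralizer] }
  have hN : (N : Set (H →L[ℂ] H)) =
      Set.centralizer (Set.centralizer (D : Set (H →L[ℂ] H))) := by
    change ((StarSubalgebra.centralizer ℂ
          (StarSubalgebra.centralizer ℂ (D : Set (H →L[ℂ] H)) : Set (H →L[ℂ] H)) :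
          StarSubalgebra ℂ (H →L[ℂ] H)) : Set (H →L[ℂ] H)) = _
    rw [StarSubalgebra.coe_centralizer_centralizer, hstar]
  rw [← hN]
  refine hS.2 N (hD.trans ?_)
  rw [hN]
  exact Set.subset_centralizer_centralizer

/-- A single square-summable family of vectors controls the seminorm of a normal tracial state. -/
lemma IsNormalTracialState.exists_twoNorm_le {M : VonNeumannAlgebra H}
    {τ : M.toStarSubalgebra →ₗ[ℂ] ℂ} (hτ : IsNormalTracialState M τ) :
    ∃ ζ : lp (fun _ : ℕ ⊕ ℕ => H) 2, ∀ b : M.toStarSubalgebra,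
      twoNorm τ b ≤ ‖amplify (ℕ ⊕ ℕ) (b : H →L[ℂ] H) ζ‖ := by
  obtain ⟨ξ, η, hξ, hη, hsum⟩ := hτ.normal
  let ζ : lp (fun _ : ℕ ⊕ ℕ => H) 2 := ⟨Sum.elim ξ η, by
    refine memℓp_gen (Summable.sum _ ?_ ?_)
    · simpa [Function.comp_def] using hξ
    · simpa [Function.comp_def] using hη⟩
  refine ⟨ζ, fun b => ?_⟩
  obtain ⟨θ, hθ⟩ : ∃ θ, θ = amplify (ℕ ⊕ ℕ) (b : H →L[ℂ] H) ζ := ⟨_, rfl⟩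
  rw [← hθ]
  have hl : ∀ i, θ (Sum.inl i) = (b : H →L[ℂ] H) (ξ i) := fun i => by rw [hθ, amplify_apply]; rfl
  have hr : ∀ i, θ (Sum.inr i) = (b : H →L[ℂ] H) (η i) := fun i => by rw [hθ, amplify_apply]; rfl
  have hθs : HasSum (fun i => ‖θ i‖ ^ 2) (‖θ‖ ^ 2) := by
    have := lp.hasSum_norm (p := 2) (by norm_num) θ
    simpa using this
  have hs1 : Summable fun i => ‖(b : H →L[ℂ] H) (ξ i)‖ ^ 2 := by
    simpa [Function.comp_def, hl] using hθs.summable.comp_injective Sum.inl_injective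
  have hs2 : Summable fun i => ‖(b : H →L[ℂ] H) (η i)‖ ^ 2 := by
    simpa [Function.comp_def, hr] using hθs.summable.comp_injective Sum.inr_injective
  have htot : (∑' i, ‖(b : H →L[ℂ] H) (ξ i)‖ ^ 2) + ∑' i, ‖(b : H →L[ℂ] H) (η i)‖ ^ 2 =
      ‖θ‖ ^ 2 := by
    refine (HasSum.sum (f := fun i => ‖θ i‖ ^ 2) ?_ ?_).unique hθs
    · simpa [Function.comp_def, hl] using hs1.hasSum
    · simpa [Function.comp_def, hr] using hs2.hasSum
  have hsum' := hsum (star b * b)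
  have hterm : ∀ i, ‖inner ℂ (η i) (((star b * b : M.toStarSubalgebra) : H →L[ℂ] H) (ξ i))‖ ≤
      ‖(b : H →L[ℂ] H) (ξ i)‖ ^ 2 + ‖(b : H →L[ℂ] H) (η i)‖ ^ 2 := by
    intro i
    have h1 : inner ℂ (η i) (((star b * b : M.toStarSubalgebra) : H →L[ℂ] H) (ξ i)) =
        inner ℂ ((b : H →L[ℂ] H) (η i)) ((b : H →L[ℂ] H) (ξ i)) :=
      ContinuousLinearMap.adjoint_inner_right (b : H →L[ℂ] H) _ _
    rw [h1]
    refine (norm_inner_le_norm _ _).trans ?_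
    nlinarith [sq_nonneg (‖(b : H →L[ℂ] H) (ξ i)‖ - ‖(b : H →L[ℂ] H) (η i)‖),
      sq_nonneg (‖(b : H →L[ℂ] H) (ξ i)‖), sq_nonneg (‖(b : H →L[ℂ] H) (η i)‖)]
  have hle : ‖τ (star b * b)‖ ≤ ‖θ‖ ^ 2 := by
    rw [← hsum'.tsum_eq, ← htot, ← Summable.tsum_add hs1 hs2]
    exact tsum_of_norm_bounded (hs1.add hs2).hasSum hterm
  calc twoNorm τ b ≤ √(‖θ‖ ^ 2) := Real.sqrt_le_sqrt ((Complex.re_le_norm _).trans hle)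
    _ = ‖θ‖ := Real.sqrt_sq (norm_nonneg _)

/-- A unital `*`-algebra generating `M` is dense in `M` for the seminorm `‖·‖₂` of a normal
tracial state. -/
lemma IsNormalTracialState.dense {M : VonNeumannAlgebra H} {τ : M.toStarSubalgebra →ₗ[ℂ] ℂ}
    (hτ : IsNormalTracialState M τ) {S : Set (H →L[ℂ] H)} (hS : IsGeneratedBySet M S)
    (D : StarSubalgebra ℂ (H →L[ℂ] H)) (hD : S ⊆ D)
    (a : M.toStarSubalgebra) {δ : ℝ} (hδ : 0 < δ) :
    ∃ d ∈ D, ∀ hd : d ∈ M.toStarSubalgebra, twoNorm τ (⟨d, hd⟩ - a) < δ := by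
  obtain ⟨ζ, hζ⟩ := hτ.exists_twoNorm_le
  obtain ⟨d, hd, hlt⟩ := exists_norm_amplify_sub_lt D (hS.subset_bicommutant D hD a.2) ζ hδ
  refine ⟨d, hd, fun hdM => (hζ _).trans_lt ?_⟩
  have h : amplify (ℕ ⊕ ℕ) (d - (a : H →L[ℂ] H)) ζ =
      amplify (ℕ ⊕ ℕ) d ζ - amplify (ℕ ⊕ ℕ) (a : H →L[ℂ] H) ζ := by
    ext i; simp
  rw [← h] at hlt
  exact hlt

end Density

/-! ### Matrix units of finite-dimensional C*-algebras -/

/-- A system of partial isometries `v_i` with common initial projections `v_{r i}` inside each class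
of indices and with final projections that sum to `1`. Each class `r⁻¹{s}` is the first column of a
system of matrix units `v_i v_j*`, and `r` selects the index whose partial isometry is the minimal
projection itself. -/
structure IsColumnSystem {A : Type*} [Ring A] [StarRing A] {I : Type*} [Fintype I] [DecidableEq I]
    (r : I → I) (v : I → A) : Prop where
  idem : ∀ i, r (r i) = r i
  star_mul : ∀ i j, star (v i) * v j = if i = j then v (r i) else 0
  sum : ∑ i, v i * star (v i) = 1

namespace IsColumnSystem

variable {A : Type*} [Ring A] [StarRing A] {I : Type*} [Fintype I] [DecidableEq I]
  {r : I → I} {v : I → A}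

lemma star_mul_self (h : IsColumnSystem r v) (i : I) : star (v i) * v i = v (r i) := by
  rw [h.star_mul, if_pos rfl]

lemma star_rep (h : IsColumnSystem r v) (i : I) : star (v (r i)) = v (r i) := by
  rw [← h.star_mul_self i]; simp

lemma rep_mul_rep (h : IsColumnSystem r v) (i : I) : v (r i) * v (r i) = v (r i) := by
  have := h.star_mul_self (r i)
  rwa [h.star_rep, h.idem] at this

lemma mul_rep (h : IsColumnSystem r v) (i : I) : v i * v (r i) = v i := by
  have h1 : v i = (∑ j, v j * star (v j)) * v i := by rw [h.sum, one_mul]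
  rw [Finset.sum_mul, Finset.sum_eq_single i] at h1
  · rw [mul_assoc, h.star_mul_self] at h1; exact h1.symm
  · intro j _ hj; rw [mul_assoc, h.star_mul, if_neg hj, mul_zero]
  · simp

end IsColumnSystem

section FiniteDimensional

variable {F : Type*} [CStarAlgebra F] [FiniteDimensional ℂ F]

lemma finite_spectrum_real (a : F) : (spectrum ℝ a).Finite := by
  have hC : (spectrum ℂ a).Finite := by
    have hint : IsIntegral ℂ a := Algebra.IsIntegral.isIntegral a
    refine ((minpoly ℂ a).roots.toFinset.finite_toSet).subset fun z hz => ?_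
    have h1 : (minpoly ℂ a).eval z ∈ spectrum ℂ (Polynomial.aeval a (minpoly ℂ a)) :=
      spectrum.subset_polynomial_aeval a _ ⟨z, hz, rfl⟩
    have hnt : Nontrivial F := by
      by_contra hF
      rw [not_nontrivial_iff_subsingleton] at hF
      simp [spectrum.of_subsingleton] at hz
    rw [minpoly.aeval, spectrum.zero_eq] at h1
    simpa [Polynomial.mem_roots, minpoly.ne_zero hint] using h1
  exact hC.preimage (f := fun t : ℝ => (t : ℂ)) (Complex.ofReal_injective.injOn)
    |>.subset fun t ht => by
      simpa using (spectrum.algebraMap_mem_iff ℂ (R := ℝ) (a := a) (r := t)).2 ht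

/-- A projection that is no sum of two nonzero orthogonal projections. -/
def IsIndecomposable (e : F) : Prop :=
  ∀ p, IsStarProjection p → p * e = p → e * p = p → p = 0 ∨ p = e

/-- The corner at an indecomposable projection is one-dimensional: any other self-adjoint element
would have a proper spectral projection. -/
lemma IsIndecomposable.exists_smul_of_isSelfAdjoint {e : F} (he : IsIndecomposable e)
    {a : F} (ha : IsSelfAdjoint a) (h1 : a * e = a) (h2 : e * a = a) :
    ∃ c : ℂ, a = c • e := by
  by_cases h0 : ∀ t ∈ spectrum ℝ a, t = 0
  · refine ⟨0, ?_⟩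
    rw [zero_smul]
    calc a = cfc (fun t : ℝ => t) a := (cfc_id' ℝ a).symm
      _ = cfc (fun _ : ℝ => 0) a := cfc_congr fun t ht => h0 t ht
      _ = 0 := by simp [cfc_const_zero]
  · push Not at h0
    obtain ⟨s, hs, hs0⟩ := h0
    have hcont : ∀ f : ℝ → ℝ, ContinuousOn f (spectrum ℝ a) :=
      fun f => (finite_spectrum_real a).continuousOn f
    let f : ℝ → ℝ := fun t => if t = s then 1 else 0
    have hap : a * cfc f a = s • cfc f a := by
      calc a * cfc f a = cfc (fun t : ℝ => t) a * cfc f a := by rw [cfc_id' ℝ a]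
        _ = cfc (fun t => t * f t) a := (cfc_mul _ _ a (hcont _) (hcont _)).symm
        _ = cfc (fun t => s • f t) a := cfc_congr fun t _ => by
            by_cases h : t = s <;> simp [f, h]
        _ = s • cfc f a := cfc_smul s f a (hcont _)
    have hcomm : cfc f a * a = a * cfc f a := (cfc_commute_cfc f (fun t => t) a).eq.trans
      (by rw [cfc_id' ℝ a]) |> fun h => by rw [cfc_id' ℝ a] at h; exact h
    have hp : IsStarProjection (cfc f a) := by
      refine ⟨?_, cfc_predicate f a⟩
      change cfc f a * cfc f a = cfc f a
      rw [← cfc_mul _ _ a (hcont _) (hcont _)]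
      refine cfc_congr fun t _ => ?_
      by_cases h : t = s <;> simp [f, h]
    have hp' : cfc f a = s⁻¹ • (a * cfc f a) := by rw [hap, smul_smul, inv_mul_cancel₀ hs0, one_smul]
    have hpe : cfc f a * e = cfc f a := by
      rw [hp', ← hcomm, smul_mul_assoc, mul_assoc, h1]
    have hep : e * cfc f a = cfc f a := by
      rw [hp', mul_smul_comm, ← mul_assoc, h2]
    have hne : cfc f a ≠ 0 := by
      intro h
      have h3 : f s ∈ spectrum ℝ (cfc f a) := by
        rw [cfc_map_spectrum f a ha (hcont _)]; exact ⟨s, hs, rfl⟩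
      have hnt : Nontrivial F := by
        by_contra hF
        rw [not_nontrivial_iff_subsingleton] at hF
        simp [spectrum.of_subsingleton] at hs
      rw [h, spectrum.zero_eq] at h3
      simp [f] at h3
    rcases he _ hp hpe hep with h | h
    · exact absurd h hne
    · refine ⟨s, ?_⟩
      rw [h, h1] at hap
      rw [hap]
      simp [Complex.coe_smul]

lemma IsIndecomposable.exists_smul {e : F} (he : IsIndecomposable e) (hp : IsStarProjection e)
    (a : F) : ∃ c : ℂ, e * a * e = c • e := by
  have hee : e * e = e := hp.isIdempotentElem
  have hse : star e = e := hp.isSelfAdjoint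
  have key : ∀ b : F, IsSelfAdjoint b → ∃ c : ℂ, e * b * e = c • e := fun b hb =>
    he.exists_smul_of_isSelfAdjoint (by
      rw [IsSelfAdjoint, star_mul, star_mul, hse, hb.star_eq, mul_assoc])
      (by rw [mul_assoc, hee]) (by rw [← mul_assoc, ← mul_assoc, hee])
  obtain ⟨c, hc⟩ := key _ (realPart a).2
  obtain ⟨d, hd⟩ := key _ (imaginaryPart a).2
  refine ⟨c + Complex.I * d, ?_⟩
  conv_lhs => rw [← realPart_add_I_smul_imaginaryPart a]
  rw [mul_add, add_mul, hc, mul_smul_comm, smul_mul_assoc, hd, add_smul, smul_smul]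

/-- There is a partition of unity into nonzero indecomposable orthogonal projections: take one
with the largest possible number of members. -/
lemma exists_partition : ∃ (n : ℕ) (e : Fin n → F), (∀ i, IsStarProjection (e i) ∧ e i ≠ 0) ∧
    (∀ i j, i ≠ j → e i * e j = 0) ∧ (∀ i, IsIndecomposable (e i)) ∧ ∑ i, e i = 1 := by
  let Q : ℕ → Prop := fun n => ∃ e : Fin n → F, (∀ i, IsStarProjection (e i) ∧ e i ≠ 0) ∧
    (∀ i j, i ≠ j → e i * e j = 0)
  have hbound : ∀ n, Q n → n ≤ Module.finrank ℂ F := by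
    rintro n ⟨e, he, ho⟩
    have hli : LinearIndependent ℂ e := by
      rw [Fintype.linearIndependent_iff]
      intro g hg i
      have := congrArg (fun x => e i * x) hg
      simp only [Finset.mul_sum, mul_smul_comm, mul_zero] at this
      rw [Finset.sum_eq_single i (fun j _ hj => by rw [ho i j hj.symm, smul_zero]) (by simp),
        (he i).1.isIdempotentElem] at this
      exact (smul_eq_zero.1 this).resolve_right (he i).2
    simpa using hli.fintype_card_le_finrank
  obtain ⟨n, ⟨e, he, ho⟩, hmax⟩ : ∃ n, Q n ∧ ¬ Q (n + 1) := by
    by_contra hcon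
    push Not at hcon
    have hall : ∀ n, Q n := fun n => Nat.rec ⟨Fin.elim0, fun i => i.elim0, fun i => i.elim0⟩
      (fun n hn => hcon n hn) n
    have := hbound _ (hall (Module.finrank ℂ F + 1))
    omega
  -- A further projection orthogonal to the others would contradict maximality.
  have hext : ∀ (f : Fin n → F) (q : F), (∀ i, IsStarProjection (f i) ∧ f i ≠ 0) →
      (∀ i j, i ≠ j → f i * f j = 0) → IsStarProjection q → (∀ i, q * f i = 0) → q = 0 := by
    intro f q hf hof hq hqf
    by_contra hq0
    refine hmax ⟨Fin.cons q f, fun i => ?_, fun i j hij => ?_⟩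
    · refine Fin.cases ⟨hq, hq0⟩ (fun i => ?_) i
      simpa using hf i
    · have hfq : ∀ i, f i * q = 0 := fun i => by
        have := congrArg star (hqf i)
        rwa [star_mul, hq.isSelfAdjoint.star_eq, (hf i).1.isSelfAdjoint.star_eq, star_zero] at this
      induction i using Fin.cases with
      | zero =>
        induction j using Fin.cases with
        | zero => exact absurd rfl hij
        | succ j => simpa using hqf j
      | succ i =>
        induction j using Fin.cases with
        | zero => simpa using hfq i
        | succ j => simpa using hof i j (fun h => hij (by rw [h]))
  refine ⟨n, e, he, ho, fun i p hp hpe hep => ?_, ?_⟩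
  · by_contra hcon
    push Not at hcon
    have hee : e i * e i = e i := (he i).1.isIdempotentElem
    have hpp : p * p = p := hp.isIdempotentElem
    have hq : IsStarProjection (e i - p) := by
      refine ⟨?_, (he i).1.isSelfAdjoint.sub hp.isSelfAdjoint⟩
      change (e i - p) * (e i - p) = e i - p
      rw [sub_mul, mul_sub, mul_sub, hee, hep, hpe, hpp, sub_self, sub_zero]
    have hpj : ∀ j, j ≠ i → p * e j = 0 := fun j hj => by
      rw [← hpe, mul_assoc, ho i j hj.symm, mul_zero]
    have hjp : ∀ j, j ≠ i → e j * p = 0 := fun j hj => by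
      rw [← hep, ← mul_assoc, ho j i hj, zero_mul]
    have := hext (Function.update e i p) (e i - p) (fun j => ?_) (fun j k hjk => ?_) hq
      (fun j => ?_)
    · exact hcon.2 (sub_eq_zero.1 this).symm
    · by_cases hj : j = i
      · subst hj; simpa using ⟨hp, hcon.1⟩
      · simpa [hj] using he j
    · by_cases hj : j = i
      · subst hj; simpa [hjk.symm] using hpj k hjk.symm
      · by_cases hk : k = i
        · subst hk; simpa [hj] using hjp j hj
        · simpa [hj, hk] using ho j k hjk
    · by_cases hj : j = i
      · subst hj; simp [sub_mul, hep, hpp]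
      · simp [hj, sub_mul, hpj j hj, ho i j (Ne.symm hj)]
  · have hsum : ∀ i, (∑ j, e j) * e i = e i := fun i => by
      rw [Finset.sum_mul, Finset.sum_eq_single i (fun j _ hj => ho j i hj) (by simp)]
      exact (he i).1.isIdempotentElem
    have hS : IsStarProjection (∑ j, e j) := by
      refine ⟨?_, ?_⟩
      · change (∑ j, e j) * (∑ j, e j) = _
        rw [Finset.mul_sum]; exact Finset.sum_congr rfl fun i _ => hsum i
      · exact isSelfAdjoint_sum _ fun i _ => (he i).1.isSelfAdjoint
    have := hext e (1 - ∑ j, e j) he ho hS.one_sub (fun i => by rw [sub_mul, hsum, one_mul, sub_self])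
    exact (sub_eq_zero.1 this).symm

/-- Indecomposable projections with a nonzero corner between them are equivalent. -/
lemma exists_partial_isometry {e f : F} (he : IsIndecomposable e) (hf : IsIndecomposable f)
    (hpe : IsStarProjection e) (hpf : IsStarProjection f) {a : F} (ha : e * a * f ≠ 0) :
    ∃ v : F, star v * v = f ∧ v * star v = e := by
  let := CStarAlgebra.spectralOrder F
  have := CStarAlgebra.spectralOrderedRing F
  have hee : e * e = e := hpe.isIdempotentElem
  have hff : f * f = f := hpf.isIdempotentElem
  have hse : star e = e := hpe.isSelfAdjoint
  have hsf : star f = f := hpf.isSelfAdjoint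
  obtain ⟨x, hx⟩ : ∃ x, x = e * a * f := ⟨_, rfl⟩
  rw [← hx] at ha
  have hex : e * x = x := by rw [hx, ← mul_assoc, ← mul_assoc, hee]
  have hxf : x * f = x := by rw [hx, mul_assoc, hff]
  have hfx : f * star x = star x := by rw [← hsf, ← star_mul, hxf]
  have hxe : star x * e = star x := by rw [← hse, ← star_mul, hex]
  obtain ⟨c, hc⟩ := hf.exists_smul hpf (star x * x)
  have hc' : star x * x = c • f := by
    rw [← hc, ← mul_assoc, hfx, mul_assoc, hxf]
  have hf0 : f ≠ 0 := by rintro rfl; exact ha (by rw [hx, mul_zero])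
  have hnf : ‖f‖ = 1 := by
    have := CStarRing.norm_star_mul_self (x := f)
    rw [hsf, hff] at this
    have h0 : ‖f‖ ≠ 0 := norm_ne_zero_iff.2 hf0
    field_simp at this
    linarith
  -- Positivity of `x* x` forces the scalar `c` to be `‖x‖²`.
  have hcn : ‖c‖ = ‖x‖ * ‖x‖ := by
    rw [← CStarRing.norm_star_mul_self, hc', norm_smul, hnf, mul_one]
  have hcx : star x * x = ((‖x‖ * ‖x‖ : ℝ) : ℂ) • f := by
    have him : c.im = 0 := by
      have h1 : star c • f = c • f := by
        rw [← hc', ← (IsSelfAdjoint.star_mul_self x).star_eq, hc', star_smul, hsf]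
      rw [← sub_eq_zero, ← sub_smul] at h1
      have h2 := congrArg Complex.im ((smul_eq_zero.1 h1).resolve_right hf0)
      simp at h2
      linarith
    have hcre : c = (c.re : ℂ) := Complex.ext rfl (by simpa using him)
    rcases le_or_gt 0 c.re with h0 | h0
    · rw [hc', ← hcn, hcre, Complex.norm_real, Real.norm_of_nonneg h0]
    · exfalso
      have h1 : star x * x + star (((√(-c.re) : ℝ) : ℂ) • f) * (((√(-c.re) : ℝ) : ℂ) • f) = 0 := by
        rw [hc', star_smul, smul_mul_smul_comm, hsf, hff]
        simp only [Complex.star_def, Complex.conj_ofReal, ← Complex.ofReal_mul]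
        rw [Real.mul_self_sqrt (by linarith), ← add_smul, hcre]
        simp
      have h2 := (add_eq_zero_iff_of_nonneg (star_mul_self_nonneg x) (star_mul_self_nonneg _)).1 h1
      exact ha ((CStarRing.star_mul_self_eq_zero_iff x).1 h2.1)
  have hx0 : ‖x‖ ≠ 0 := norm_ne_zero_iff.2 ha
  set v : F := ((‖x‖⁻¹ : ℝ) : ℂ) • x with hv
  have hvv : star v * v = f := by
    rw [hv, star_smul, smul_mul_smul_comm, hcx, smul_smul]
    simp only [Complex.star_def, Complex.conj_ofReal, ← Complex.ofReal_mul]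
    rw [show ‖x‖⁻¹ * ‖x‖⁻¹ * (‖x‖ * ‖x‖) = 1 by field_simp]
    simp
  have hvf : v * f = v := by rw [hv, smul_mul_assoc, hxf]
  have hev : e * v = v := by rw [hv, mul_smul_comm, hex]
  have hve : star v * e = star v := by rw [← hse, ← star_mul, hev]
  refine ⟨v, hvv, ?_⟩
  have hproj : v * star v * (v * star v) = v * star v := by
    rw [mul_assoc, ← mul_assoc (star v), hvv, ← mul_assoc, hvf]
  rcases he (v * star v) ⟨hproj, IsSelfAdjoint.mul_star_self v⟩ (by rw [mul_assoc, hve])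
    (by rw [← mul_assoc, hev]) with h | h
  · rw [CStarRing.mul_star_self_eq_zero_iff] at h
    rw [h, mul_zero] at hvv
    exact absurd hvv.symm hf0
  · exact h

/-- A finite-dimensional C*-algebra is spanned by the matrix units of a column system. -/
lemma exists_columnSystem (F : Type*) [CStarAlgebra F] [FiniteDimensional ℂ F] :
    ∃ (n : ℕ) (r : Fin n → Fin n) (v : Fin n → F), IsColumnSystem r v ∧
      ∀ a : F, ∃ c : Fin n → Fin n → ℂ, (∀ i j, r i ≠ r j → c i j = 0) ∧
        a = ∑ i, ∑ j, c i j • (v i * star (v j)) := by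
  obtain ⟨n, e, hne, ho, hmin, hsum⟩ := exists_partition (F := F)
  have hp : ∀ i, IsStarProjection (e i) := fun i => (hne i).1
  have hee : ∀ i, e i * e i = e i := fun i => (hp i).isIdempotentElem
  have hse : ∀ i, star (e i) = e i := fun i => (hp i).isSelfAdjoint
  let E : Setoid (Fin n) :=
    { r := fun i j => ∃ v : F, star v * v = e j ∧ v * star v = e i
      iseqv :=
        { refl := fun i => ⟨e i, by rw [hse, hee], by rw [hse, hee]⟩
          symm := fun {i j} ⟨v, h1, h2⟩ => ⟨star v, by rwa [star_star], by rwa [star_star]⟩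
          trans := fun {i j k} ⟨v, h1, h2⟩ ⟨w, h3, h4⟩ => ⟨v * w, by
            rw [star_mul, mul_assoc, ← mul_assoc (star v), h1, ← h4,
              ← mul_assoc, ← mul_assoc, h3, mul_assoc, h3, hee], by
            rw [star_mul, mul_assoc, ← mul_assoc w, h4, ← h1, ← mul_assoc, ← mul_assoc, h2,
              mul_assoc, h2, hee]⟩ } }
  let r : Fin n → Fin n := fun i => (Quotient.mk E i).out
  have hr : ∀ i, E i (r i) := fun i => E.symm (Quotient.mk_out i)
  have hrr : ∀ i, r (r i) = r i := fun i => by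
    change (Quotient.mk E (r i)).out = (Quotient.mk E i).out
    rw [Quotient.sound (E.symm (hr i))]
  choose w hw1 hw2 using hr
  let v : Fin n → F := fun i => if r i = i then e i else w i
  have hv1 : ∀ i, star (v i) * v i = e (r i) := fun i => by
    by_cases h : r i = i
    · simp [v, h, hse, hee]
    · simp [v, h, hw1]
  have hv2 : ∀ i, v i * star (v i) = e i := fun i => by
    by_cases h : r i = i
    · simp [v, h, hse, hee]
    · simp [v, h, hw2]
  have hvr : ∀ i, v (r i) = e (r i) := fun i => by simp [v, hrr]
  have hve : ∀ i, v i * e (r i) = v i := fun i => by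
    have h0 : (v i * e (r i) - v i) * star (v i * e (r i) - v i) = 0 := by
      have h1 : v i * e (r i) * star (v i) = e i := by
        rw [← hv1, ← mul_assoc, hv2, mul_assoc, hv2, hee]
      rw [star_sub, star_mul, hse, sub_mul, mul_sub, mul_sub, ← mul_assoc, mul_assoc (v i) (e (r i)),
        hee, h1, ← mul_assoc, h1, hv2, sub_self]
    rw [CStarRing.mul_star_self_eq_zero_iff] at h0
    exact sub_eq_zero.1 h0
  have hev : ∀ i, e i * v i = v i := fun i => by
    rw [← hv2, mul_assoc, hv1, hve]
  have hsve : ∀ i, star (v i) * e i = star (v i) := fun i => by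
    rw [← hse, ← star_mul, hev]
  have hesv : ∀ i, e (r i) * star (v i) = star (v i) := fun i => by
    rw [← hse (r i), ← star_mul, hve]
  refine ⟨n, r, v, ⟨hrr, fun i j => ?_, by simp_rw [hv2]; exact hsum⟩, fun a => ?_⟩
  · split_ifs with h
    · subst h; rw [hv1, hvr]
    · rw [← hsve, ← hev j, mul_assoc, ← mul_assoc (e i), ho i j h, zero_mul, mul_zero]
  · have hc : ∀ i j, ∃ c : ℂ, (r i ≠ r j → c = 0) ∧ e i * a * e j = c • (v i * star (v j)) := by
      intro i j
      have h1 : e i * a * e j = v i * (e (r i) * (star (v i) * a * v j) * e (r j)) * star (v j) := by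
        rw [← mul_assoc, ← mul_assoc, ← mul_assoc, ← mul_assoc, hve, hv2, mul_assoc, mul_assoc,
          hesv, mul_assoc, ← mul_assoc, hv2]
      by_cases hij : r i = r j
      · obtain ⟨c, hc⟩ := (hmin (r i)).exists_smul (hp (r i)) (star (v i) * a * v j)
        refine ⟨c, fun h => absurd hij h, ?_⟩
        rw [h1, ← hij, hc, mul_smul_comm, smul_mul_assoc, hve]
      · refine ⟨0, fun _ => rfl, ?_⟩
        have h2 : e (r i) * (star (v i) * a * v j) * e (r j) = 0 := by
          by_contra hcon
          refine hij ?_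
          have h3 : E (r i) (r j) :=
            exists_partial_isometry (hmin _) (hmin _) (hp _) (hp _) hcon
          have h4 : r (r i) = r (r j) := congrArg Quotient.out (Quotient.sound h3)
          rwa [hrr, hrr] at h4
        rw [h1, h2, mul_zero, zero_mul, zero_smul]
    choose c hc1 hc2 using hc
    refine ⟨c, hc1, ?_⟩
    simp_rw [← hc2]
    simp_rw [← Finset.mul_sum, hsum, mul_one, ← Finset.sum_mul, hsum, one_mul]

end FiniteDimensional

/-! ### Near-unitaries and near-projections in matrix algebras -/

/-- The unitary part `W = X S⁻¹`, `S = |X|`, of an invertible `X` is as close to `X` as `X* X` is to `1`,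
because `X - W = W (1 + S)⁻¹ (S² - 1)`. -/
lemma IsTracialState.exists_unitary_of_isUnit {A : Type*} [CStarAlgebra A] {τ : A →ₗ[ℂ] ℂ}
    (hτ : IsTracialState τ) {X : A} (hX : IsUnit X) :
    ∃ W ∈ unitary A, twoNorm τ (X - W) ≤ twoNorm τ (star X * X - 1) := by
  let := CStarAlgebra.spectralOrder A
  have := CStarAlgebra.spectralOrderedRing A
  set S := CFC.sqrt (star X * X) with hS
  have hSS : S * S = star X * X := CFC.sqrt_mul_sqrt_self _ (star_mul_self_nonneg X)
  have hS0 : 0 ≤ S := CFC.sqrt_nonneg _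
  have hst : star S = S := (IsSelfAdjoint.of_nonneg hS0).star_eq
  have hSu : IsUnit S := by
    have : IsUnit (S ^ 2) := by rw [pow_two, hSS]; exact hX.star.mul hX
    exact (isUnit_pow_iff two_ne_zero).1 this
  obtain ⟨s, hs⟩ := hSu
  set t : A := ((s⁻¹ : Aˣ) : A) with ht
  have h1 : S * t = 1 := by rw [← hs]; simp [ht]
  have h2 : t * S = 1 := by rw [← hs]; simp [ht]
  have h3 : star t = t := by
    have h4 : star t * S = 1 := by
      have := congrArg star h1
      simpa [hst] using this
    calc star t = star t * (S * t) := by rw [h1, mul_one]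
      _ = t := by rw [← mul_assoc, h4, one_mul]
  have hW1 : star (X * t) * (X * t) = 1 := by
    rw [star_mul, h3, mul_assoc, ← mul_assoc (star X), ← hSS, mul_assoc, h1, mul_one, h2]
  have hWu : IsUnit (X * t) := hX.mul ⟨s⁻¹, rfl⟩
  have hW2 : (X * t) * star (X * t) = 1 := by
    refine hWu.mul_right_cancel ?_
    rw [mul_assoc, hW1, mul_one, one_mul]
  refine ⟨X * t, Unitary.mem_iff.2 ⟨hW1, hW2⟩, ?_⟩
  obtain ⟨d, hd⟩ := CStarAlgebra.nonneg_iff_eq_star_mul_self.1 hS0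
  obtain ⟨w, -, hw, -, hwn, -, -⟩ := exists_inverse d
  rw [← hd] at hw
  have hXW : X - X * t = (X * t) * (w * (star X * X - 1)) := by
    have h5 : w * (star X * X - 1) = S - 1 := by
      rw [← hSS, show S * S - 1 = (1 + S) * (S - 1) by noncomm_ring, ← mul_assoc, hw, one_mul]
    rw [h5, mul_sub, mul_one, mul_assoc, h2, mul_one]
  have hWn : ‖X * t‖ ≤ 1 := by
    have := CStarRing.norm_star_mul_self (x := X * t)
    rw [hW1] at this
    rcases subsingleton_or_nontrivial A with h | h
    · simp [Subsingleton.elim (X * t) 0]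
    · rw [norm_one] at this
      nlinarith [norm_nonneg (X * t)]
  rw [hXW]
  have h0 := twoNorm_nonneg τ (star X * X - 1)
  calc _ ≤ ‖X * t‖ * (‖w‖ * twoNorm τ (star X * X - 1)) :=
        (hτ.mul_le_left _ _).trans
          (mul_le_mul_of_nonneg_left (hτ.mul_le_left _ _) (norm_nonneg _))
    _ ≤ 1 * (1 * twoNorm τ (star X * X - 1)) := by gcongr
    _ = _ := by ring

/-- A matrix that is nearly isometric is close to a unitary: the polar part of a nearby invertible
matrix. -/
lemma exists_unitary_near {k : ℕ} (hk : 1 ≤ k) (X : Matrix (Fin k) (Fin k) ℂ) {η : ℝ}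
    (hη : 0 < η) : ∃ W ∈ Matrix.unitaryGroup (Fin k) ℂ,
      twoNorm (matTrace k) (X - W) ≤ twoNorm (matTrace k) (star X * X - 1) + η := by
  have hτ := isTracialState_matTrace hk
  have hfin : {t : ℝ | (-(t : ℂ)) ∈ spectrum ℂ X}.Finite :=
    (Matrix.finite_spectrum X).preimage (f := fun t : ℝ => -(t : ℂ))
      (fun a _ b _ h => by simpa using h)
  set t₀ : ℝ := min 1 (η / (2 * ‖X‖ + 2)) with ht₀
  have ht₀p : 0 < t₀ := lt_min one_pos (by positivity)
  obtain ⟨t, ⟨ht0, ht1⟩, htX⟩ := ((Set.Ioo_infinite ht₀p).sdiff hfin).nonempty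
  have hunit : IsUnit (X + (t : ℂ) • 1) := by
    have h1 : IsUnit (algebraMap ℂ (Matrix (Fin k) (Fin k) ℂ) (-(t : ℂ)) - X) := by
      by_contra h; exact htX h
    have h2 : X + (t : ℂ) • 1 = -(algebraMap ℂ (Matrix (Fin k) (Fin k) ℂ) (-(t : ℂ)) - X) := by
      rw [Algebra.algebraMap_eq_smul_one, neg_smul]; abel
    rw [h2]; exact h1.neg
  obtain ⟨W, hW, hle⟩ := hτ.exists_unitary_of_isUnit hunit
  refine ⟨W, hW, ?_⟩
  have htn : ‖(t : ℂ)‖ = t := by rw [Complex.norm_real, Real.norm_of_nonneg ht0.le]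
  have e1 : twoNorm (matTrace k) ((t : ℂ) • 1) = t := by
    rw [hτ.smul, hτ.twoNorm_one, htn, mul_one]
  have e2 : X - W = (X + (t : ℂ) • 1 - W) - (t : ℂ) • 1 := by abel
  have e3 : star (X + (t : ℂ) • 1) * (X + (t : ℂ) • 1) - 1 =
      (star X * X - 1) + (t : ℂ) • (X + star X + (t : ℂ) • 1) := by
    simp only [star_add, star_smul, star_one, Complex.star_def, Complex.conj_ofReal, add_mul,
      mul_add, smul_mul_assoc, mul_smul_comm, mul_one, one_mul, smul_add]
    abel
  have hX := hτ.twoNorm_le X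
  have e4 : twoNorm (matTrace k) ((t : ℂ) • (X + star X + (t : ℂ) • 1)) ≤ t * (2 * ‖X‖ + 1) := by
    rw [hτ.smul, htn]
    have := hτ.add_le (X + star X) ((t : ℂ) • 1)
    have h' := hτ.add_le X (star X)
    rw [hτ.twoNorm_star] at h'
    have : t ≤ 1 := ht1.le.trans (min_le_left _ _)
    refine mul_le_mul_of_nonneg_left ?_ ht0.le
    linarith
  have e5 : t * (2 * ‖X‖ + 2) ≤ η := by
    have := ht1.le.trans (min_le_right 1 (η / (2 * ‖X‖ + 2)))
    rwa [le_div_iff₀ (by positivity)] at this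
  rw [e3] at hle
  rw [e2]
  have h6 := hτ.sub_le (X + (t : ℂ) • 1 - W) ((t : ℂ) • 1)
  have h7 := hτ.add_le (star X * X - 1) ((t : ℂ) • (X + star X + (t : ℂ) • 1))
  linarith

/-- Comparison of two numbers in `[0,1]` that are not separated by the threshold `1/2` in the wrong
order: both are close to their roundings to `{0,1}`. -/
lemma sq_sub_le_of_threshold {s t : ℝ} (hs : s ∈ Set.Icc (0 : ℝ) 1) (ht : t ∈ Set.Icc (0 : ℝ) 1)
    (h : 1 / 2 ≤ s → 1 / 2 ≤ t) :
    (s - t) ^ 2 ≤ 4 * (s - s ^ 2) + 4 * (t - t ^ 2) + (t - s) := by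
  obtain ⟨hs0, hs1⟩ := hs
  obtain ⟨ht0, ht1⟩ := ht
  rcases le_or_gt (1 / 2) s with h1 | h1
  · have h2 := h h1
    nlinarith [mul_nonneg (sub_nonneg.2 hs1) (sub_nonneg.2 h1),
      mul_nonneg (sub_nonneg.2 ht1) (sub_nonneg.2 h2), mul_nonneg hs0 ht0,
      mul_nonneg (sub_nonneg.2 hs1) (sub_nonneg.2 ht1)]
  · rcases le_or_gt (1 / 2) t with h2 | h2
    · nlinarith [mul_nonneg hs0 (sub_nonneg.2 h1.le), mul_nonneg (sub_nonneg.2 ht1) (sub_nonneg.2 h2),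
        mul_nonneg hs0 (sub_nonneg.2 ht1), mul_nonneg hs0 ht0]
    · nlinarith [mul_nonneg hs0 (sub_nonneg.2 h1.le), mul_nonneg ht0 (sub_nonneg.2 h2.le),
        mul_nonneg hs0 ht0]

lemma sum_sq_sub_le {ι : Type*} [Fintype ι] {s t : ι → ℝ} (hs : ∀ i, s i ∈ Set.Icc (0 : ℝ) 1)
    (ht : ∀ i, t i ∈ Set.Icc (0 : ℝ) 1)
    (h : (∀ i, 1 / 2 ≤ s i → 1 / 2 ≤ t i) ∨ (∀ i, 1 / 2 ≤ t i → 1 / 2 ≤ s i)) :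
    ∑ i, (s i - t i) ^ 2 ≤ 4 * ∑ i, (s i - s i ^ 2) + 4 * ∑ i, (t i - t i ^ 2) +
      |∑ i, s i - ∑ i, t i| := by
  rcases h with h | h
  · calc _ ≤ ∑ i, (4 * (s i - s i ^ 2) + 4 * (t i - t i ^ 2) + (t i - s i)) :=
          Finset.sum_le_sum fun i _ => sq_sub_le_of_threshold (hs i) (ht i) (h i)
      _ ≤ _ := by
          rw [Finset.sum_add_distrib, Finset.sum_add_distrib, ← Finset.mul_sum, ← Finset.mul_sum,
            Finset.sum_sub_distrib t s]
          linarith [neg_abs_le (∑ i, s i - ∑ i, t i)]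
  · calc _ ≤ ∑ i, (4 * (t i - t i ^ 2) + 4 * (s i - s i ^ 2) + (s i - t i)) :=
          Finset.sum_le_sum fun i _ => by
            rw [← neg_sq, neg_sub]; exact sq_sub_le_of_threshold (ht i) (hs i) (h i)
      _ ≤ _ := by
          rw [Finset.sum_add_distrib, Finset.sum_add_distrib, ← Finset.mul_sum, ← Finset.mul_sum,
            Finset.sum_sub_distrib s t]
          linarith [le_abs_self (∑ i, s i - ∑ i, t i)]

/-- The spectral theorem for `P* P` with a contraction `P`, the eigenvalues `d` being listed in
decreasing order along a fixed enumeration of the index set. -/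
lemma exists_diagonalization {k : ℕ} {P : Matrix (Fin k) (Fin k) ℂ} (hP : ‖P‖ ≤ 1) :
    ∃ U ∈ Matrix.unitaryGroup (Fin k) ℂ, ∃ d : Fin k → ℝ, (∀ i, d i ∈ Set.Icc (0 : ℝ) 1) ∧
      Antitone (fun j => d (Fintype.equivOfCardEq (Fintype.card_fin (Fintype.card (Fin k))) j)) ∧
      star P * P = U * Matrix.diagonal (fun i => (d i : ℂ)) * star U := by
  have h : (star P * P).IsHermitian := IsSelfAdjoint.star_mul_self P
  refine ⟨h.eigenvectorUnitary, h.eigenvectorUnitary.2, h.eigenvalues, fun i => ⟨?_, ?_⟩, ?_, ?_⟩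
  · exact (Matrix.posSemidef_conjTranspose_mul_self P).eigenvalues_nonneg i
  · have h1 := spectrum.norm_le_norm_mul_of_mem (h.eigenvalues_mem_spectrum_real i)
    have : Nonempty (Fin k) := ⟨i⟩
    rw [CStarRing.norm_star_mul_self, norm_one, mul_one] at h1
    have := Real.le_norm_self (h.eigenvalues i)
    nlinarith [norm_nonneg P]
  · intro i j hij
    simpa [Matrix.IsHermitian.eigenvalues] using h.eigenvalues₀_antitone hij
  · conv_lhs => rw [h.spectral_theorem, Unitary.conjStarAlgAut_apply]
    rfl

/-- Two positive contractions are unitarily close when both nearly are projections and their traces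
nearly agree: conjugate one onto the other by matching the eigenvalues in decreasing order. -/
lemma exists_unitary_conj_near {k : ℕ} (hk : 1 ≤ k) {P Q : Matrix (Fin k) (Fin k) ℂ}
    (hP : ‖P‖ ≤ 1) (hQ : ‖Q‖ ≤ 1) : ∃ W ∈ Matrix.unitaryGroup (Fin k) ℂ,
      twoNorm (matTrace k) (star P * P - W * (star Q * Q) * star W) ^ 2 ≤
        4 * ‖matTrace k (star P * P - (star P * P) * (star P * P))‖ +
        4 * ‖matTrace k (star Q * Q - (star Q * Q) * (star Q * Q))‖ +
        ‖matTrace k (star P * P - star Q * Q)‖ := by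
  have hk0 : (0 : ℝ) < k := by exact_mod_cast hk
  have hτ := isTracialState_matTrace hk
  have hTr : ∀ (U : Matrix (Fin k) (Fin k) ℂ) (d : Fin k → ℝ), star U * U = 1 →
      matTrace k (U * Matrix.diagonal (fun i => (d i : ℂ)) * star U) =
        (((k : ℝ)⁻¹ * ∑ i, d i : ℝ) : ℂ) := by
    intro U d hU
    rw [hτ.trace, ← mul_assoc, hU, one_mul, matTrace_apply, normTrace, Matrix.trace_diagonal]
    push_cast; rfl
  have hSq : ∀ (U : Matrix (Fin k) (Fin k) ℂ) (d : Fin k → ℝ), star U * U = 1 →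
      (U * Matrix.diagonal (fun i => (d i : ℂ)) * star U) *
        (U * Matrix.diagonal (fun i => (d i : ℂ)) * star U) =
      U * Matrix.diagonal (fun i => ((d i ^ 2 : ℝ) : ℂ)) * star U := by
    intro U d hU
    calc _ = U * Matrix.diagonal (fun i => (d i : ℂ)) * (star U * U) *
          Matrix.diagonal (fun i => (d i : ℂ)) * star U := by noncomm_ring
      _ = _ := by
        rw [hU, mul_one, mul_assoc U, Matrix.diagonal_mul_diagonal]
        simp [pow_two]
  obtain ⟨U, hU, s, hs, hs', hPd⟩ := exists_diagonalization hP
  obtain ⟨V, hV, t, ht, ht', hQd⟩ := exists_diagonalization hQ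
  have hU1 : star U * U = 1 := (Unitary.mem_iff.1 hU).1
  have hV1 : star V * V = 1 := (Unitary.mem_iff.1 hV).1
  refine ⟨U * star V, mul_mem hU (Unitary.star_mem hV), ?_⟩
  -- Both thresholds cut the decreasingly ordered spectra in initial segments, which are nested.
  have hcomp : (∀ i, 1 / 2 ≤ s i → 1 / 2 ≤ t i) ∨ (∀ i, 1 / 2 ≤ t i → 1 / 2 ≤ s i) := by
    by_contra hcon
    push Not at hcon
    obtain ⟨⟨i, hi1, hi2⟩, ⟨j, hj1, hj2⟩⟩ := hcon
    let e := Fintype.equivOfCardEq (Fintype.card_fin (Fintype.card (Fin k)))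
    rcases le_total (e.symm i) (e.symm j) with h | h
    · have h1 : t (e (e.symm j)) ≤ t (e (e.symm i)) := ht' h
      simp only [Equiv.apply_symm_apply] at h1
      linarith
    · have h1 : s (e (e.symm i)) ≤ s (e (e.symm j)) := hs' h
      simp only [Equiv.apply_symm_apply] at h1
      linarith
  have hsum := sum_sq_sub_le hs ht hcomp
  have hdiff : star P * P - U * star V * (star Q * Q) * star (U * star V) =
      U * Matrix.diagonal (fun i => ((s i - t i : ℝ) : ℂ)) * star U := by
    have h2 : Matrix.diagonal (fun i => ((s i - t i : ℝ) : ℂ)) =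
        Matrix.diagonal (fun i => (s i : ℂ)) - Matrix.diagonal (fun i => (t i : ℂ)) := by
      rw [Matrix.diagonal_sub]; simp
    rw [h2, hPd, hQd, star_mul, star_star]
    calc _ = U * Matrix.diagonal (fun i => (s i : ℂ)) * star U -
          U * (star V * V) * Matrix.diagonal (fun i => (t i : ℂ)) * (star V * V) * star U := by
            noncomm_ring
      _ = _ := by rw [hV1]; noncomm_ring
  have hnorm : twoNorm (matTrace k) (star P * P - U * star V * (star Q * Q) * star (U * star V)) ^ 2
      = (k : ℝ)⁻¹ * ∑ i, (s i - t i) ^ 2 := by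
    have h2 : star (Matrix.diagonal (fun i => ((s i - t i : ℝ) : ℂ))) =
        Matrix.diagonal (fun i => ((s i - t i : ℝ) : ℂ)) := by
      rw [Matrix.star_eq_conjTranspose, Matrix.diagonal_conjTranspose]
      congr 1; ext i; simp
    rw [hdiff]
    apply Complex.ofReal_injective
    rw [hτ.sq_twoNorm, ← hTr U _ hU1, ← hSq U _ hU1, star_mul, star_mul, star_star, h2, ← mul_assoc U]
  rw [hnorm, map_sub, map_sub, map_sub, hPd, hQd, hSq _ _ hU1, hSq _ _ hV1, hTr _ _ hU1, hTr _ _ hU1,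
    hTr _ _ hV1, hTr _ _ hV1]
  simp only [← Complex.ofReal_sub, ← mul_sub, ← Finset.sum_sub_distrib, Complex.norm_real,
    norm_mul, Real.norm_eq_abs]
  rw [abs_of_pos (inv_pos.2 hk0)]
  have hsn := le_abs_self (∑ i, (s i - s i ^ 2))
  have htn := le_abs_self (∑ i, (t i - t i ^ 2))
  rw [← Finset.sum_sub_distrib] at hsum
  calc (k : ℝ)⁻¹ * ∑ i, (s i - t i) ^ 2
      ≤ (k : ℝ)⁻¹ * (4 * |∑ i, (s i - s i ^ 2)| + 4 * |∑ i, (t i - t i ^ 2)| +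
        |∑ i, (s i - t i)|) := by
        refine mul_le_mul_of_nonneg_left ?_ (inv_pos.2 hk0).le
        linarith
    _ = _ := by ring

/-! ### Conjugating approximate column systems -/

/-- A family of contractions that satisfies the relations of a column system up to `η` in the
seminorm `‖·‖₂`. -/
structure IsApproxColumnSystem {A : Type*} [CStarAlgebra A] {I : Type*} [Fintype I] [DecidableEq I]
    (τ : A →ₗ[ℂ] ℂ) (η : ℝ) (r : I → I) (V : I → A) : Prop where
  norm_le : ∀ i, ‖V i‖ ≤ 1
  star_mul : ∀ i j, twoNorm τ (star (V i) * V j - if i = j then V (r i) else 0) ≤ η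
  mul_rep : ∀ i, twoNorm τ (V i * V (r i) - V i) ≤ η
  sum : twoNorm τ (∑ i, V i * star (V i) - 1) ≤ η

section Intertwiner

variable {A : Type*} [CStarAlgebra A] {I : Type*} [Fintype I] [DecidableEq I]
  {τ : A →ₗ[ℂ] ℂ} {η : ℝ} {r : I → I} {V U W : I → A}

lemma norm_le_one_of_mem_unitary {w : A} (hw : w ∈ unitary A) : ‖w‖ ≤ 1 := by
  have h := CStarRing.norm_star_mul_self (x := w)
  rw [(Unitary.mem_iff.1 hw).1] at h
  rcases subsingleton_or_nontrivial A with h' | h'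
  · simp [Subsingleton.elim w 0]
  · rw [norm_one] at h
    nlinarith [norm_nonneg w]

lemma norm_mul_le_one {a b : A} (ha : ‖a‖ ≤ 1) (hb : ‖b‖ ≤ 1) : ‖a * b‖ ≤ 1 :=
  (norm_mul_le a b).trans (mul_le_one₀ ha (norm_nonneg b) hb)

lemma norm_star_le_one {a : A} (ha : ‖a‖ ≤ 1) : ‖star a‖ ≤ 1 := by rwa [norm_star]

/-- The map `∑ V_i w_{r i} U_i*` that carries the column system `U` to the column system `V` when
each unitary `w_s` carries the projection `U_s` to `V_s`. -/
def intertwiner (r : I → I) (V U W : I → A) : A := ∑ i, V i * W (r i) * star (U i)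

/-- In a sum of contractive multiples of `V_i* V_j` over `j`, only the term `j = i` matters. -/
lemma IsApproxColumnSystem.sum_star_mul_le (hτ : IsTracialState τ)
    (hV : IsApproxColumnSystem τ η r V) (i : I) (b : A) (c : I → A) (hb : ‖b‖ ≤ 1)
    (hc : ∀ j, ‖c j‖ ≤ 1) :
    twoNorm τ (∑ j, b * (star (V i) * V j) * c j - b * V (r i) * c i) ≤ Fintype.card I * η := by
  have h1 : ∑ j, b * (star (V i) * V j) * c j - b * V (r i) * c i =
      ∑ j, b * (star (V i) * V j - if i = j then V (r i) else 0) * c j := by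
    simp only [mul_sub, sub_mul, Finset.sum_sub_distrib]
    congr 1
    rw [Finset.sum_eq_single i (fun j _ hj => by rw [if_neg hj.symm]; simp) (by simp)]
    simp
  rw [h1]
  refine (hτ.sum_le _ _).trans ?_
  calc _ ≤ ∑ _j : I, η := Finset.sum_le_sum fun j _ =>
        (hτ.conj_le _ hb (hc j)).trans (hV.star_mul i j)
    _ = _ := by simp

/-- The intertwiner of two approximate column systems is nearly isometric. -/
lemma twoNorm_intertwiner_star_mul_self_sub_one_le (hτ : IsTracialState τ)
    (hV : IsApproxColumnSystem τ η r V) (hU : IsApproxColumnSystem τ η r U)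
    (hW : ∀ i, W i ∈ unitary A)
    (hVU : ∀ i, twoNorm τ (V (r i) - W (r i) * U (r i) * star (W (r i))) ≤ η) :
    twoNorm τ (star (intertwiner r V U W) * intertwiner r V U W - 1) ≤
      (Fintype.card I * (Fintype.card I + 2) + 1) * η := by
  have hWn : ∀ i, ‖W i‖ ≤ 1 := fun i => norm_le_one_of_mem_unitary (hW i)
  set X := intertwiner r V U W with hX
  have h0 : star X * X = ∑ i, ∑ j, (U i * star (W (r i))) * (star (V i) * V j) *
      (W (r j) * star (U j)) := by
    simp only [hX, intertwiner, star_sum, Finset.sum_mul_sum, star_mul, star_star]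
    refine Finset.sum_congr rfl fun i _ => Finset.sum_congr rfl fun j _ => ?_
    noncomm_ring
  have hterm : ∀ i, twoNorm τ (∑ j, (U i * star (W (r i))) * (star (V i) * V j) *
      (W (r j) * star (U j)) - U i * star (U i)) ≤ (Fintype.card I + 2) * η := by
    intro i
    have hb : ‖U i * star (W (r i))‖ ≤ 1 :=
      norm_mul_le_one (hU.norm_le i) (norm_star_le_one (hWn _))
    have h1 := hV.sum_star_mul_le hτ i (U i * star (W (r i))) (fun j => W (r j) * star (U j)) hb
      (fun j => norm_mul_le_one (hWn _) (norm_star_le_one (hU.norm_le j)))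
    have h2 : twoNorm τ (U i * star (W (r i)) * V (r i) * (W (r i) * star (U i)) -
        U i * U (r i) * star (U i)) ≤ η := by
      have hWW := (Unitary.mem_iff.1 (hW (r i))).1
      have e : U i * star (W (r i)) * V (r i) * (W (r i) * star (U i)) - U i * U (r i) * star (U i) =
          (U i * star (W (r i))) * (V (r i) - W (r i) * U (r i) * star (W (r i))) *
            (W (r i) * star (U i)) := by
        calc _ = U i * star (W (r i)) * V (r i) * (W (r i) * star (U i)) -
              U i * (star (W (r i)) * W (r i)) * U (r i) * (star (W (r i)) * W (r i)) *
                star (U i) := by rw [hWW]; noncomm_ring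
          _ = _ := by noncomm_ring
      rw [e]
      exact (hτ.conj_le _ hb (norm_mul_le_one (hWn _) (norm_star_le_one (hU.norm_le i)))).trans
        (hVU i)
    have h3 : twoNorm τ (U i * U (r i) * star (U i) - U i * star (U i)) ≤ η := by
      rw [← sub_mul]
      have := hτ.conj_le (a := (1 : A)) (c := star (U i)) (U i * U (r i) - U i)
        (norm_le_one_of_mem_unitary (one_mem _)) (norm_star_le_one (hU.norm_le i))
      rw [one_mul] at this
      exact this.trans (hU.mul_rep i)
    have h4 := hτ.triangle _ _ _ |>.trans (add_le_add h1 (hτ.triangle _ _ _ |>.trans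
      (add_le_add h2 h3)))
    linarith
  have h5 : star X * X - 1 = ∑ i, (∑ j, (U i * star (W (r i))) * (star (V i) * V j) *
      (W (r j) * star (U j)) - U i * star (U i)) + (∑ i, U i * star (U i) - 1) := by
    rw [h0, Finset.sum_sub_distrib]; abel
  rw [h5]
  refine (hτ.add_le _ _).trans ?_
  have h6 := (hτ.sum_le Finset.univ fun i => ∑ j, (U i * star (W (r i))) * (star (V i) * V j) *
      (W (r j) * star (U j)) - U i * star (U i)).trans (Finset.sum_le_sum fun i _ => hterm i)
  simp only [Finset.sum_const, Finset.card_univ, nsmul_eq_mul] at h6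
  linarith [hU.sum]

/-- The intertwiner of two approximate column systems nearly intertwines the elements with the same
coefficients. -/
lemma twoNorm_mul_intertwiner_sub_le (hτ : IsTracialState τ)
    (hV : IsApproxColumnSystem τ η r V) (hU : IsApproxColumnSystem τ η r U)
    (hW : ∀ i, W i ∈ unitary A)
    (hVU : ∀ i, twoNorm τ (V (r i) - W (r i) * U (r i) * star (W (r i))) ≤ η)
    {c : I → I → ℂ} (hc : ∀ i j, r i ≠ r j → c i j = 0) :
    twoNorm τ ((∑ i, ∑ j, c i j • (V i * star (V j))) * intertwiner r V U W -
        intertwiner r V U W * ∑ i, ∑ j, c i j • (U i * star (U j))) ≤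
      (∑ i, ∑ j, ‖c i j‖) * ((2 * Fintype.card I + 1) * η) := by
  have hWn : ∀ i, ‖W i‖ ≤ 1 := fun i => norm_le_one_of_mem_unitary (hW i)
  have hone : ‖(1 : A)‖ ≤ 1 := norm_le_one_of_mem_unitary (one_mem _)
  set X := intertwiner r V U W with hX
  set N : ℝ := ((Fintype.card I : ℕ) : ℝ)
  have hterm : ∀ i j, r i = r j →
      twoNorm τ (V i * star (V j) * X - X * (U i * star (U j))) ≤ (2 * N + 1) * η := by
    intro i j hij
    have hWW := (Unitary.mem_iff.1 (hW (r i))).1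
    -- Both sides are compared with `V_i V_{r i} W_{r i} U_j*`.
    have h1 : twoNorm τ (V i * star (V j) * X - V i * V (r i) * (W (r i) * star (U j))) ≤
        N * η := by
      have := hV.sum_star_mul_le hτ j (V i) (fun k => W (r k) * star (U k)) (hV.norm_le i)
        (fun k => norm_mul_le_one (hWn _) (norm_star_le_one (hU.norm_le k)))
      rw [← hij] at this
      convert this using 3
      rw [hX, intertwiner, Finset.mul_sum]
      exact Finset.sum_congr rfl fun k _ => by noncomm_ring
    have h2 : twoNorm τ (X * (U i * star (U j)) - V i * W (r i) * U (r i) * star (U j)) ≤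
        N * η := by
      have h3 : twoNorm τ (X * (U i * star (U j)) - V i * W (r i) * U (r i) * star (U j)) =
          twoNorm τ (∑ k, U j * (star (U i) * U k) * (star (W (r k)) * star (V k)) -
            U j * star (U (r i)) * (star (W (r i)) * star (V i))) := by
        rw [← hτ.twoNorm_star]
        congr 1
        simp only [hX, intertwiner, star_sub, star_mul, star_sum, star_star, Finset.mul_sum]
        congr 1
        · exact Finset.sum_congr rfl fun k _ => by noncomm_ring
        · noncomm_ring
      have h3' : ∀ k, (star (U i) * U k - if k = i then star (U (r i)) else 0) =
          star (star (U k) * U i - if k = i then U (r k) else 0) := by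
        intro k
        by_cases hk : k = i
        · subst hk; simp
        · simp [hk]
      rw [h3]
      have h4 : ∑ k, U j * (star (U i) * U k) * (star (W (r k)) * star (V k)) -
            U j * star (U (r i)) * (star (W (r i)) * star (V i)) =
          ∑ k, U j * (star (U i) * U k - if k = i then star (U (r i)) else 0) *
            (star (W (r k)) * star (V k)) := by
        simp only [mul_sub, sub_mul, Finset.sum_sub_distrib]
        congr 1
        rw [Finset.sum_eq_single i (fun k _ hk => by rw [if_neg hk]; simp) (by simp)]
        simp
      rw [h4]
      refine (hτ.sum_le _ _).trans ?_
      calc _ ≤ ∑ _k : I, η := Finset.sum_le_sum fun k _ => by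
            refine (hτ.conj_le _ (hU.norm_le j) (norm_mul_le_one (norm_star_le_one (hWn _))
              (norm_star_le_one (hV.norm_le k)))).trans ?_
            rw [h3', hτ.twoNorm_star]
            exact hU.star_mul k i
        _ = _ := by simp [N]
    have h5 : twoNorm τ (V i * V (r i) * (W (r i) * star (U j)) -
        V i * W (r i) * U (r i) * star (U j)) ≤ η := by
      have e : V i * V (r i) * (W (r i) * star (U j)) - V i * W (r i) * U (r i) * star (U j) =
          V i * (V (r i) - W (r i) * U (r i) * star (W (r i))) * (W (r i) * star (U j)) := by
        calc _ = V i * V (r i) * (W (r i) * star (U j)) -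
            V i * W (r i) * U (r i) * (star (W (r i)) * W (r i)) * star (U j) := by
              rw [hWW, mul_one]
          _ = _ := by noncomm_ring
      rw [e]
      exact (hτ.conj_le _ (hV.norm_le i)
        (norm_mul_le_one (hWn _) (norm_star_le_one (hU.norm_le j)))).trans (hVU i)
    have h6 := hτ.triangle _ _ _ |>.trans (add_le_add h1 (hτ.triangle _ _ _ |>.trans
      (add_le_add h5 ((hτ.sub_comm _ _).le.trans h2))))
    linarith
  have e : (∑ i, ∑ j, c i j • (V i * star (V j))) * X - X * ∑ i, ∑ j, c i j • (U i * star (U j)) =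
      ∑ i, ∑ j, c i j • (V i * star (V j) * X - X * (U i * star (U j))) := by
    simp only [Finset.sum_mul, Finset.mul_sum, smul_mul_assoc, mul_smul_comm,
      ← Finset.sum_sub_distrib, smul_sub]
  rw [e, Finset.sum_mul]
  refine (hτ.sum_le _ _).trans (Finset.sum_le_sum fun i _ => ?_)
  rw [Finset.sum_mul]
  refine (hτ.sum_le _ _).trans (Finset.sum_le_sum fun j _ => ?_)
  rw [hτ.smul]
  by_cases hij : r i = r j
  · exact mul_le_mul_of_nonneg_left (hterm i j hij) (norm_nonneg _)
  · simp [hc i j hij]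

omit [DecidableEq I] in
lemma norm_sum_smul_le (hV : ∀ i, ‖V i‖ ≤ 1) (c : I → I → ℂ) :
    ‖∑ i, ∑ j, c i j • (V i * star (V j))‖ ≤ ∑ i, ∑ j, ‖c i j‖ := by
  refine (norm_sum_le _ _).trans (Finset.sum_le_sum fun i _ => (norm_sum_le _ _).trans
    (Finset.sum_le_sum fun j _ => ?_))
  rw [norm_smul]
  exact mul_le_of_le_one_right (norm_nonneg _) (norm_mul_le_one (hV i) (norm_star_le_one (hV j)))

/-- For an approximate column system the representative `V_{r i}` is nearly a projection. -/
lemma IsApproxColumnSystem.rep_near (hτ : IsTracialState τ) (hr : ∀ i, r (r i) = r i)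
    (hV : IsApproxColumnSystem τ η r V) (i : I) :
    twoNorm τ (star (V (r i)) * V (r i) - V (r i)) ≤ η ∧
    twoNorm τ (star (V (r i)) * V (r i) -
      (star (V (r i)) * V (r i)) * (star (V (r i)) * V (r i))) ≤ 2 * η := by
  set P := V (r i) with hP
  have hone : ‖(1 : A)‖ ≤ 1 := norm_le_one_of_mem_unitary (one_mem _)
  have hPn : ‖P‖ ≤ 1 := hV.norm_le _
  have h1 : twoNorm τ (star P * P - P) ≤ η := by
    have := hV.star_mul (r i) (r i)
    rwa [if_pos rfl, hr] at this
  have h2 : twoNorm τ (P * P - P) ≤ η := by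
    have := hV.mul_rep (r i)
    rwa [hr] at this
  refine ⟨h1, ?_⟩
  have e : star P * P - (star P * P) * (star P * P) =
      -(star P * (P * P - P) * 1 + (star P * P) * (star P * P - P) * 1) := by noncomm_ring
  rw [e, hτ.neg]
  have h3 := hτ.conj_le (P * P - P) (norm_star_le_one hPn) hone
  have h4 := hτ.conj_le (star P * P - P) (norm_mul_le_one (norm_star_le_one hPn) hPn) hone
  linarith [hτ.add_le (star P * (P * P - P) * 1) ((star P * P) * (star P * P - P) * 1)]

end Intertwiner

lemma norm2_le_sum {n k : ℕ} (A : Fin n → Matrix (Fin k) (Fin k) ℂ) (hk : 1 ≤ k) :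
    norm2 A ≤ ∑ j, twoNorm (matTrace k) (A j) := by
  have h : ∀ j, (normTrace (star (A j) * A j)).re = twoNorm (matTrace k) (A j) ^ 2 := fun j =>
    (Real.sq_sqrt ((isTracialState_matTrace hk).nonneg (A j)).1).symm
  rw [norm2, Real.sqrt_le_left (Finset.sum_nonneg fun j _ => twoNorm_nonneg _ _)]
  simp_rw [h]
  exact Finset.sum_sq_le_sq_sum_of_nonneg fun j _ => twoNorm_nonneg _ _

/-- If a unitary `Z` is close to an element `X` that nearly intertwines `p` and `q`, then it nearly
conjugates elements near `q` to elements near `p`. -/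
lemma twoNorm_sub_conj_le {A : Type*} [CStarAlgebra A] {τ : A →ₗ[ℂ] ℂ} (hτ : IsTracialState τ)
    {Z : A} (hZ : Z ∈ unitary A) {a b p q X : A} {C ρ α β : ℝ} (hp : ‖p‖ ≤ C) (hq : ‖q‖ ≤ C)
    (ha : twoNorm τ (a - p) ≤ ρ) (hb : twoNorm τ (b - q) ≤ ρ)
    (hpq : twoNorm τ (p * X - X * q) ≤ α) (hX : twoNorm τ (X - Z) ≤ β) :
    twoNorm τ (a - Z * b * star Z) ≤ 2 * ρ + α + 2 * C * β := by
  have hZZ : Z * star Z = 1 := (Unitary.mem_iff.1 hZ).2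
  have hZn : ‖Z‖ ≤ 1 := norm_le_one_of_mem_unitary hZ
  have hone : ‖(1 : A)‖ ≤ 1 := norm_le_one_of_mem_unitary (one_mem _)
  have hC0 : 0 ≤ C := (norm_nonneg p).trans hp
  have hβ0 : 0 ≤ β := (twoNorm_nonneg _ _).trans hX
  have e : a - Z * b * star Z = (a - p) +
      1 * ((p * X - X * q) - p * (X - Z) + (X - Z) * q) * star Z - Z * (b - q) * star Z := by
    calc _ = (a - p) + p * (Z * star Z) - Z * b * star Z := by rw [hZZ]; noncomm_ring
      _ = _ := by noncomm_ring
  have h3 : twoNorm τ (p * (X - Z)) ≤ C * β :=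
    (hτ.mul_le_left _ _).trans (mul_le_mul hp hX (twoNorm_nonneg _ _) hC0)
  have h4 : twoNorm τ ((X - Z) * q) ≤ β * C :=
    (hτ.mul_le_right _ _).trans (mul_le_mul hX hq (norm_nonneg _) hβ0)
  have h5 := hτ.add_le ((p * X - X * q) - p * (X - Z)) ((X - Z) * q)
  have h6 := hτ.sub_le (p * X - X * q) (p * (X - Z))
  have h7 := hτ.conj_le ((p * X - X * q) - p * (X - Z) + (X - Z) * q) hone (norm_star_le_one hZn)
  have h8 := hτ.conj_le (b - q) hZn (norm_star_le_one hZn)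
  rw [e]
  have h9 := hτ.sub_le ((a - p) + 1 * ((p * X - X * q) - p * (X - Z) + (X - Z) * q) * star Z)
    (Z * (b - q) * star Z)
  have h10 := hτ.add_le (a - p) (1 * ((p * X - X * q) - p * (X - Z) + (X - Z) * q) * star Z)
  linarith

/-- The representatives of two approximate column systems with nearly the same traces are unitarily
close. -/
lemma exists_unitary_rep_near {k : ℕ} (hk : 1 ≤ k) {I : Type*} [Fintype I] [DecidableEq I]
    {r : I → I} (hr : ∀ i, r (r i) = r i) {V U : I → Matrix (Fin k) (Fin k) ℂ} {η : ℝ}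
    (hη0 : 0 < η) (hη1 : η ≤ 1) (hV : IsApproxColumnSystem (matTrace k) (η ^ 2 / 76) r V)
    (hU : IsApproxColumnSystem (matTrace k) (η ^ 2 / 76) r U) (i : I)
    (htr : ‖matTrace k (V (r i)) - matTrace k (U (r i))‖ ≤ η ^ 2 / 76) :
    ∃ W ∈ Matrix.unitaryGroup (Fin k) ℂ,
      twoNorm (matTrace k) (V (r i) - W * U (r i) * star W) ≤ η := by
  have hτ := isTracialState_matTrace hk
  obtain ⟨δ, hδ⟩ : ∃ δ, δ = η ^ 2 / 76 := ⟨_, rfl⟩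
  rw [← hδ] at hV hU htr
  have hδη : 4 * δ ≤ η := by nlinarith
  obtain ⟨W, hW, hle⟩ := exists_unitary_conj_near hk (hV.norm_le (r i)) (hU.norm_le (r i))
  refine ⟨W, hW, ?_⟩
  obtain ⟨hv1, hv2⟩ := hV.rep_near hτ hr i
  obtain ⟨hu1, hu2⟩ := hU.rep_near hτ hr i
  have hWn : ‖W‖ ≤ 1 := norm_le_one_of_mem_unitary hW
  set P := V (r i)
  set Q := U (r i)
  have h1 := (hτ.norm_le _).trans hv2
  have h2 := (hτ.norm_le _).trans hu2
  have h3 : ‖matTrace k (star P * P - star Q * Q)‖ ≤ 3 * δ := by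
    have e : matTrace k (star P * P - star Q * Q) = matTrace k (star P * P - P) +
        (matTrace k P - matTrace k Q) - matTrace k (star Q * Q - Q) := by
      simp only [map_sub]; ring
    rw [e]
    have h4 := (hτ.norm_le _).trans hv1
    have h5 := (hτ.norm_le _).trans hu1
    have h6 := htr
    have h7 := norm_sub_le (matTrace k (star P * P - P) + (matTrace k P - matTrace k Q))
      (matTrace k (star Q * Q - Q))
    have h8 := norm_add_le (matTrace k (star P * P - P)) (matTrace k P - matTrace k Q)
    linarith
  have h4 : twoNorm (matTrace k) (star P * P - W * (star Q * Q) * star W) ≤ η / 2 := by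
    refine (sq_le_sq₀ (twoNorm_nonneg _ _) (by positivity)).1 (hle.trans ?_)
    have : (η / 2) ^ 2 = 19 * δ := by rw [hδ]; ring
    linarith
  have e : P - W * Q * star W = (star P * P - W * (star Q * Q) * star W) -
      (star P * P - P) + W * (star Q * Q - Q) * star W := by noncomm_ring
  rw [e]
  have h5 := hτ.conj_le (star Q * Q - Q) hWn (norm_star_le_one hWn)
  have h6 := hτ.add_le ((star P * P - W * (star Q * Q) * star W) - (star P * P - P))
    (W * (star Q * Q - Q) * star W)
  have h7 := hτ.sub_le (star P * P - W * (star Q * Q) * star W) (star P * P - P)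
  linarith

/-- Two tuples of matrices with nearly the same coefficients in approximate column systems that
have nearly the same traces lie in the same orbit-ball. The distance allowed from the tuples to the
span of the column systems does not depend on the systems. -/
lemma exists_mem_orbitBall {n : ℕ} {I : Type*} [Fintype I] [DecidableEq I] {r : I → I}
    (hr : ∀ i, r (r i) = r i) (c : Fin n → I → I → ℂ)
    (hc : ∀ j i i', r i ≠ r i' → c j i i' = 0) {ω : ℝ} (hω : 0 < ω) :
    ∃ δ > 0, ∀ (k : ℕ) (_ : 1 ≤ k) (A B : Fin n → Matrix (Fin k) (Fin k) ℂ)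
      (V U : I → Matrix (Fin k) (Fin k) ℂ),
      IsApproxColumnSystem (matTrace k) δ r V → IsApproxColumnSystem (matTrace k) δ r U →
      (∀ i, ‖matTrace k (V (r i)) - matTrace k (U (r i))‖ ≤ δ) →
      (∀ j, twoNorm (matTrace k) (A j - ∑ i, ∑ i', c j i i' • (V i * star (V i'))) ≤
        ω / (4 * (n + 1))) →
      (∀ j, twoNorm (matTrace k) (B j - ∑ i, ∑ i', c j i i' • (U i * star (U i'))) ≤
        ω / (4 * (n + 1))) →
      A ∈ orbitBall B ω := by
  set N : ℝ := ((Fintype.card I : ℕ) : ℝ) with hN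
  set C : ℝ := ∑ j, ∑ i, ∑ i', ‖c j i i'‖ with hC
  have hN0 : 0 ≤ N := Nat.cast_nonneg _
  have hC0 : 0 ≤ C := by positivity
  set K : ℝ := C * (2 * N + 1) + 2 * C * ((N * (N + 2) + 1) + 1) with hK
  have hK0 : 0 ≤ K := by positivity
  -- `η` bounds the final error; `δ` is such that `√(19 δ) + 2 δ ≤ η`.
  set η : ℝ := min 1 (ω / (2 * (n + 1) * (K + 1))) with hη
  have hη0 : 0 < η := lt_min one_pos (by positivity)
  have hη1 : η ≤ 1 := min_le_left _ _
  have hn0 : (0 : ℝ) ≤ n := Nat.cast_nonneg _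
  have hηω : n * (K * η) ≤ ω / 2 := by
    have h1 : η * (2 * (n + 1) * (K + 1)) ≤ ω := by
      rw [← le_div_iff₀ (by positivity)]; exact min_le_right _ _
    have h2 : (n : ℝ) * (K * η) ≤ (n + 1) * (K + 1) * η := by
      nlinarith [mul_nonneg hn0 hη0.le, mul_nonneg hK0 hη0.le]
    nlinarith
  refine ⟨η ^ 2 / 76, by positivity, ?_⟩
  set δ : ℝ := η ^ 2 / 76 with hδ
  intro k hk A B V U hV hU htr hAV hBU
  have hτ := isTracialState_matTrace hk
  have hδη' : δ ≤ η := by nlinarith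
  have hex : ∀ i, ∃ W ∈ Matrix.unitaryGroup (Fin k) ℂ,
      twoNorm (matTrace k) (V (r i) - W * U (r i) * star W) ≤ η :=
    fun i => exists_unitary_rep_near hk hr hη0 hη1 hV hU i (htr i)
  choose W hW hVU using hex
  have hV' : IsApproxColumnSystem (matTrace k) η r V :=
    ⟨hV.norm_le, fun i j => (hV.star_mul i j).trans hδη', fun i => (hV.mul_rep i).trans hδη',
      hV.sum.trans hδη'⟩
  have hU' : IsApproxColumnSystem (matTrace k) η r U :=
    ⟨hU.norm_le, fun i j => (hU.star_mul i j).trans hδη', fun i => (hU.mul_rep i).trans hδη',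
      hU.sum.trans hδη'⟩
  have hVU' : ∀ i, twoNorm (matTrace k) (V (r i) - W (r i) * U (r i) * star (W (r i))) ≤ η := by
    intro i
    have := hVU (r i)
    rwa [hr] at this
  have hX1 := twoNorm_intertwiner_star_mul_self_sub_one_le hτ hV' hU' hW hVU'
  have hX2 := fun j => twoNorm_mul_intertwiner_sub_le hτ hV' hU' hW hVU' (hc j)
  set X := intertwiner r V U W
  obtain ⟨Z, hZ, hZle⟩ := exists_unitary_near hk X hη0
  refine ⟨Z, hZ, ?_⟩
  have hj : ∀ j, twoNorm (matTrace k) (A j - Z * B j * star Z) ≤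
      2 * (ω / (4 * (n + 1))) + K * η := by
    intro j
    have hCj : ∑ i, ∑ i', ‖c j i i'‖ ≤ C :=
      Finset.single_le_sum (f := fun j => ∑ i, ∑ i', ‖c j i i'‖)
        (fun _ _ => by positivity) (Finset.mem_univ j)
    have h1 := (hX2 j).trans (mul_le_mul_of_nonneg_right hCj (by positivity))
    have h2 : twoNorm (matTrace k) (X - Z) ≤ ((N * (N + 2) + 1) + 1) * η := by linarith
    have h3 := twoNorm_sub_conj_le hτ hZ ((norm_sum_smul_le hV.norm_le (c j)).trans hCj)
      ((norm_sum_smul_le hU.norm_le (c j)).trans hCj) (hAV j) (hBU j) h1 h2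
    rw [hK]
    linarith
  calc norm2 (fun j => A j - Z * B j * star Z)
      ≤ ∑ j, twoNorm (matTrace k) (A j - Z * B j * star Z) := norm2_le_sum _ hk
    _ ≤ ∑ _j : Fin n, (2 * (ω / (4 * (n + 1))) + K * η) := Finset.sum_le_sum fun j _ => hj j
    _ = ω / 2 * (n / (n + 1)) + n * (K * η) := by
        simp only [Finset.sum_const, Finset.card_univ, Fintype.card_fin, nsmul_eq_mul]
        field_simp
        ring
    _ < ω / 2 + ω / 2 := by
        refine add_lt_add_of_lt_of_le (mul_lt_of_lt_one_right (by positivity) ?_) hηω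
        rw [div_lt_one (by positivity)]
        linarith
    _ = ω := by ring

/-! ### Microstate sequences as a C*-algebra -/

section StarWord

variable {A : Type*} [Monoid A] [Star A] {n : ℕ} (x : Fin n → A)

lemma starWord_nil : starWord x [] = 1 := rfl

lemma starWord_append (u w : List (Fin n × Bool)) :
    starWord x (u ++ w) = starWord x u * starWord x w := by
  simp [starWord]

end StarWord

lemma map_starWord {A B : Type*} [Ring A] [StarRing A] [Algebra ℂ A] [Ring B] [StarRing B]
    [Algebra ℂ B] (φ : A →⋆ₐ[ℂ] B) {n : ℕ} (x : Fin n → A) (w : List (Fin n × Bool)) :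
    φ (starWord x w) = starWord (fun j => φ (x j)) w := by
  induction w with
  | nil => simp [starWord]
  | cons p w ih =>
    simp only [starWord, List.map_cons, List.prod_cons, map_mul] at ih ⊢
    rw [ih]
    congr 1
    split_ifs <;> simp [map_star]

/-- The `*`-algebra generated by `x` is spanned by the `*`-words in `x`. -/
lemma adjoin_induction_starWord {A : Type*} [Ring A] [StarRing A] [Algebra ℂ A] [StarModule ℂ A]
    {n : ℕ} (x : Fin n → A) (S : Submodule ℂ A) (hS : ∀ w, starWord x w ∈ S) {a : A}
    (ha : a ∈ StarAlgebra.adjoin ℂ (Set.range x)) : a ∈ S := by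
  have h1 : a ∈ Algebra.adjoin ℂ (Set.range x ∪ star (Set.range x)) := by
    rw [← StarAlgebra.adjoin_toSubalgebra]; exact ha
  rw [← Subalgebra.mem_toSubmodule, Algebra.adjoin_eq_span] at h1
  refine Submodule.span_le.2 (fun b hb => ?_) h1
  suffices h : ∃ w, b = starWord x w by
    obtain ⟨w, rfl⟩ := h
    exact hS w
  induction hb using Submonoid.closure_induction with
  | mem y hy =>
    rcases hy with ⟨j, rfl⟩ | ⟨j, hj⟩
    · exact ⟨[(j, false)], by simp [starWord]⟩
    · exact ⟨[(j, true)], by simp [starWord, hj]⟩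
  | one => exact ⟨[], rfl⟩
  | mul y z _ _ hy hz =>
    obtain ⟨u, rfl⟩ := hy
    obtain ⟨w, rfl⟩ := hz
    exact ⟨u ++ w, (starWord_append x u w).symm⟩

/-- Bounded families in C*-algebras form a C*-algebra. -/
scoped instance {ι : Type*} {G : ι → Type*} [∀ i, Nontrivial (G i)] [∀ i, CStarAlgebra (G i)] :
    CStarAlgebra (lp G ⊤) where

/-- Evaluation of a bounded family at an index. -/
def lpEval {ι : Type*} (G : ι → Type*) [∀ i, Nontrivial (G i)] [∀ i, CStarAlgebra (G i)] (i : ι) :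
    lp G ⊤ →⋆ₐ[ℂ] G i where
  toFun f := f i
  map_one' := rfl
  map_mul' _ _ := rfl
  map_zero' := rfl
  map_add' _ _ := rfl
  commutes' _ := rfl
  map_star' _ := rfl

/-- The elements on which a net of functionals of norm at most one converges to a given one form a
closed subspace. -/
def convergenceSubmodule {A ι : Type*} [CStarAlgebra A] (𝓛 : Filter ι) (σ : ι → A →ₗ[ℂ] ℂ)
    (σ₀ : A →ₗ[ℂ] ℂ) : Submodule ℂ A where
  carrier := {a | Tendsto (fun i => σ i a) 𝓛 (𝓝 (σ₀ a))}
  add_mem' ha hb := by simpa using ha.add hb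
  zero_mem' := by simpa using tendsto_const_nhds
  smul_mem' c a ha := by simpa using ha.const_mul c

lemma isClosed_convergenceSubmodule {A ι : Type*} [CStarAlgebra A] (𝓛 : Filter ι)
    {σ : ι → A →ₗ[ℂ] ℂ} {σ₀ : A →ₗ[ℂ] ℂ} (hσ : ∀ i a, ‖σ i a‖ ≤ ‖a‖) (hσ₀ : ∀ a, ‖σ₀ a‖ ≤ ‖a‖) :
    IsClosed (convergenceSubmodule 𝓛 σ σ₀ : Set A) := by
  refine isClosed_of_closure_subset fun a ha => ?_
  change Tendsto (fun i => σ i a) 𝓛 (𝓝 (σ₀ a))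
  rw [Metric.tendsto_nhds]
  intro ε hε
  obtain ⟨d, hd, hda⟩ := Metric.mem_closure_iff.1 ha (ε / 3) (by positivity)
  have hd' : Tendsto (fun i => σ i d) 𝓛 (𝓝 (σ₀ d)) := hd
  filter_upwards [Metric.tendsto_nhds.1 hd' (ε / 3) (by positivity)] with i hi
  rw [dist_eq_norm] at hi hda ⊢
  have h1 := hσ i (a - d)
  have h2 := hσ₀ (a - d)
  have e : σ i a - σ₀ a = σ i (a - d) + (σ i d - σ₀ d) - σ₀ (a - d) := by
    simp only [map_sub]; ring
  rw [e]
  have h3 := norm_sub_le (σ i (a - d) + (σ i d - σ₀ d)) (σ₀ (a - d))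
  have h4 := norm_add_le (σ i (a - d)) (σ i d - σ₀ d)
  linarith

/-- A net of bounded tuples of matrices that converges in `*`-moments to a tuple `x` in a tracial
C*-algebra is the image of a single tuple in a C*-algebra on which the traces converge pointwise. -/
lemma exists_limit_model.{u} {M : Type u} [CStarAlgebra M] {τ : M →ₗ[ℂ] ℂ} (hτ : IsTracialState τ)
    {n : ℕ} (x : Fin n → M) {ι : Type} (𝓛 : Filter ι) (K : ι → ℕ)
    (A : ∀ i, Fin n → Matrix (Fin (K i + 1)) (Fin (K i + 1)) ℂ) (R : ℝ) (hA : ∀ i j, ‖A i j‖ ≤ R)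
    (hlim : ∀ w, Tendsto (fun i => matTrace _ (starWord (A i) w)) 𝓛 (𝓝 (τ (starWord x w)))) :
    ∃ (𝒜 : Type u) (_ : CStarAlgebra 𝒜) (π : 𝒜 →⋆ₐ[ℂ] M)
      (φ : ∀ i, 𝒜 →⋆ₐ[ℂ] Matrix (Fin (K i + 1)) (Fin (K i + 1)) ℂ) (y : Fin n → 𝒜),
      (∀ j, π (y j) = x j) ∧ (∀ i j, φ i (y j) = A i j) ∧
      ∀ a, Tendsto (fun i => matTrace _ (φ i a)) 𝓛 (𝓝 (τ (π a))) := by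
  let G : ι → Type := fun i => Matrix (Fin (K i + 1)) (Fin (K i + 1)) ℂ
  let y₀ : Fin n → M × lp G ⊤ := fun j => (x j, ⟨fun i => A i j, memℓp_infty
    ⟨R, by rintro _ ⟨i, rfl⟩; exact hA i j⟩⟩)
  let 𝒜 := (StarAlgebra.adjoin ℂ (Set.range y₀)).topologicalClosure
  have hcl : IsClosed (𝒜 : Set (M × lp G ⊤)) := StarSubalgebra.isClosed_topologicalClosure _
  let π₀ : M × lp G ⊤ →⋆ₐ[ℂ] M := StarAlgHom.fst ℂ M (lp G ⊤)
  let φ₀ : ∀ i, M × lp G ⊤ →⋆ₐ[ℂ] G i := fun i => (lpEval G i).comp (StarAlgHom.snd ℂ M (lp G ⊤))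
  have hmat : ∀ i, IsTracialState (matTrace (K i + 1)) :=
    fun i => isTracialState_matTrace (Nat.le_add_left 1 (K i))
  let σ : ι → (M × lp G ⊤) →ₗ[ℂ] ℂ :=
    fun i => matTrace (K i + 1) ∘ₗ (φ₀ i : M × lp G ⊤ →ₐ[ℂ] G i).toLinearMap
  let σ₀ : (M × lp G ⊤) →ₗ[ℂ] ℂ := τ ∘ₗ (π₀ : M × lp G ⊤ →ₐ[ℂ] M).toLinearMap
  have hclosed := isClosed_convergenceSubmodule 𝓛 (σ := σ) (σ₀ := σ₀)
    (fun i => ((hmat i).comp (φ₀ i)).norm_le_norm) ((hτ.comp π₀).norm_le_norm)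
  have hconv : ∀ a ∈ 𝒜, Tendsto (fun i => σ i a) 𝓛 (𝓝 (σ₀ a)) := by
    intro a ha
    refine closure_minimal (s := (StarAlgebra.adjoin ℂ (Set.range y₀) : Set (M × lp G ⊤)))
      (fun b hb => ?_) hclosed ha
    refine adjoin_induction_starWord y₀ (convergenceSubmodule 𝓛 σ σ₀) (fun w => ?_) hb
    have h1 : ∀ i, σ i (starWord y₀ w) = matTrace _ (starWord (A i) w) := fun i =>
      congrArg (matTrace (K i + 1)) (map_starWord (φ₀ i) y₀ w)
    have h2 : σ₀ (starWord y₀ w) = τ (starWord x w) := congrArg τ (map_starWord π₀ y₀ w)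
    change Tendsto (fun i => σ i (starWord y₀ w)) 𝓛 (𝓝 (σ₀ (starWord y₀ w)))
    simp_rw [h1, h2]
    exact hlim w
  refine ⟨𝒜, StarSubalgebra.cstarAlgebra 𝒜, π₀.comp 𝒜.subtype, fun i => (φ₀ i).comp 𝒜.subtype,
    fun j => ⟨y₀ j, StarSubalgebra.le_topologicalClosure _
      (StarAlgebra.subset_adjoin ℂ _ ⟨j, rfl⟩)⟩, fun j => rfl, fun i j => rfl,
    fun a => hconv a a.2⟩

lemma tendsto_twoNorm {M 𝒜 : Type*} [CStarAlgebra M] [CStarAlgebra 𝒜] {τ : M →ₗ[ℂ] ℂ}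
    {ι : Type*} {𝓛 : Filter ι} {K : ι → ℕ} {π : 𝒜 →⋆ₐ[ℂ] M}
    {φ : ∀ i, 𝒜 →⋆ₐ[ℂ] Matrix (Fin (K i + 1)) (Fin (K i + 1)) ℂ}
    (h : ∀ a, Tendsto (fun i => matTrace _ (φ i a)) 𝓛 (𝓝 (τ (π a)))) (a : 𝒜) :
    Tendsto (fun i => twoNorm (matTrace _) (φ i a)) 𝓛 (𝓝 (twoNorm τ (π a))) := by
  have h1 := h (star a * a)
  simp only [map_mul, map_star] at h1
  exact (Real.continuous_sqrt.tendsto _).comp ((Complex.continuous_re.tendsto _).comp h1)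

namespace IsColumnSystem

lemma map {A B : Type*} [Ring A] [StarRing A] [Algebra ℂ A] [Ring B] [StarRing B] [Algebra ℂ B]
    {I : Type*} [Fintype I] [DecidableEq I] {r : I → I} {v : I → A} (h : IsColumnSystem r v)
    (φ : A →⋆ₐ[ℂ] B) : IsColumnSystem r (fun i => φ (v i)) where
  idem := h.idem
  star_mul i j := by
    rw [← map_star, ← map_mul, h.star_mul]; split_ifs <;> simp
  sum := by
    simp_rw [← map_star, ← map_mul]
    rw [← map_sum, h.sum, map_one]

variable {A : Type*} [CStarAlgebra A] {I : Type*} [Fintype I] [DecidableEq I]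
  {r : I → I} {v : I → A}

lemma norm_le (h : IsColumnSystem r v) (i : I) : ‖v i‖ ≤ 1 := by
  have h1 : ‖v (r i)‖ = ‖v (r i)‖ * ‖v (r i)‖ := by
    conv_lhs => rw [← h.rep_mul_rep i]
    rw [← CStarRing.norm_star_mul_self, h.star_rep]
  have h2 : ‖v (r i)‖ = ‖v i‖ * ‖v i‖ := by
    rw [← h.star_mul_self, CStarRing.norm_star_mul_self]
  have h3 : ‖v (r i)‖ ≤ 1 := by
    by_contra hcon
    nlinarith
  nlinarith [norm_nonneg (v i)]

/-- Contractions close to a column system form an approximate column system. -/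
lemma approx {τ : A →ₗ[ℂ] ℂ} (hτ : IsTracialState τ) (h : IsColumnSystem r v) {V : I → A} {δ : ℝ}
    (hV : ∀ i, ‖V i‖ ≤ 1) (hVv : ∀ i, twoNorm τ (V i - v i) ≤ δ) (hδ : 0 ≤ δ) :
    IsApproxColumnSystem τ ((2 * Fintype.card I + 3) * δ) r V := by
  have hone : ‖(1 : A)‖ ≤ 1 := norm_le_one_of_mem_unitary (one_mem _)
  have hN : (0 : ℝ) ≤ Fintype.card I := Nat.cast_nonneg _
  have hNδ : 0 ≤ Fintype.card I * δ := mul_nonneg hN hδ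
  -- Products of two contractions move by at most `2 δ`.
  have hprod : ∀ a b a' b' : A, ‖b‖ ≤ 1 → ‖a'‖ ≤ 1 → twoNorm τ (a - a') ≤ δ →
      twoNorm τ (b - b') ≤ δ → twoNorm τ (a * b - a' * b') ≤ 2 * δ := by
    intro a b a' b' hb ha' h1 h2
    have e : a * b - a' * b' = 1 * (a - a') * b + a' * (b - b') * 1 := by noncomm_ring
    rw [e]
    have h3 := hτ.conj_le (a - a') hone hb
    have h4 := hτ.conj_le (b - b') ha' hone
    linarith [hτ.add_le (1 * (a - a') * b) (a' * (b - b') * 1)]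
  have hstar : ∀ i, twoNorm τ (star (V i) - star (v i)) ≤ δ := fun i => by
    rw [← star_sub, hτ.twoNorm_star]; exact hVv i
  refine ⟨hV, fun i j => ?_, fun i => ?_, ?_⟩
  · have h1 := hprod _ _ _ _ (hV j) (norm_star_le_one (h.norm_le i)) (hstar i) (hVv j)
    have h2 : twoNorm τ ((if i = j then v (r i) else 0) - if i = j then V (r i) else 0) ≤ δ := by
      split_ifs
      · rw [hτ.sub_comm]; exact hVv _
      · simpa [twoNorm_zero] using hδ
    rw [← h.star_mul] at h2
    have h3 := hτ.triangle _ _ _ |>.trans (add_le_add h1 h2)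
    linarith
  · have h1 := hprod _ _ _ _ (hV (r i)) (h.norm_le i) (hVv i) (hVv (r i))
    rw [h.mul_rep] at h1
    have h2 := hτ.triangle _ _ _ |>.trans (add_le_add h1 ((hτ.sub_comm _ _).le.trans (hVv i)))
    linarith
  · have h1 : ∑ i, V i * star (V i) - 1 = ∑ i, (V i * star (V i) - v i * star (v i)) := by
      rw [Finset.sum_sub_distrib, h.sum]
    rw [h1]
    refine (hτ.sum_le _ _).trans ?_
    have h2 := Finset.sum_le_sum fun i (_ : i ∈ Finset.univ) =>
      hprod _ _ _ _ (norm_star_le_one (hV i)) (h.norm_le i) (hVv i) (hstar i)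
    simp only [Finset.sum_const, Finset.card_univ, nsmul_eq_mul] at h2
    linarith

/-- The span coordinates of an element change little when a column system is replaced by nearby
contractions. -/
lemma twoNorm_sum_smul_sub_le {τ : A →ₗ[ℂ] ℂ} (hτ : IsTracialState τ) (h : IsColumnSystem r v)
    {V : I → A} {δ : ℝ} (hV : ∀ i, ‖V i‖ ≤ 1) (hVv : ∀ i, twoNorm τ (V i - v i) ≤ δ)
    (c : I → I → ℂ) :
    twoNorm τ (∑ i, ∑ j, c i j • (v i * star (v j)) - ∑ i, ∑ j, c i j • (V i * star (V j))) ≤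
      (∑ i, ∑ j, ‖c i j‖) * (2 * δ) := by
  have hone : ‖(1 : A)‖ ≤ 1 := norm_le_one_of_mem_unitary (one_mem _)
  simp only [← Finset.sum_sub_distrib, ← smul_sub, Finset.sum_mul]
  refine (hτ.sum_le _ _).trans (Finset.sum_le_sum fun i _ =>
    (hτ.sum_le _ _).trans (Finset.sum_le_sum fun j _ => ?_))
  rw [hτ.smul]
  refine mul_le_mul_of_nonneg_left ?_ (norm_nonneg _)
  have e : v i * star (v j) - V i * star (V j) =
      -(1 * (V i - v i) * star (V j) + v i * star (V j - v j) * 1) := by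
    rw [star_sub]; noncomm_ring
  rw [e, hτ.neg]
  have h3 := hτ.conj_le (V i - v i) hone (norm_star_le_one (hV j))
  have h4 := hτ.conj_le (star (V j - v j)) (h.norm_le i) hone
  rw [hτ.twoNorm_star] at h4
  linarith [hτ.add_le (1 * (V i - v i) * star (V j)) (v i * star (V j - v j) * 1), hVv i, hVv j]

end IsColumnSystem

/-! ### Uniqueness of microstates up to conjugation -/

section Uniqueness

variable {H : Type*} [NormedAddCommGroup H] [InnerProductSpace ℂ H] [CompleteSpace H]

lemma Generates.exists_adjoin_dense {M : VonNeumannAlgebra H} {τ : M.toStarSubalgebra →ₗ[ℂ] ℂ}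
    (hτ : IsNormalTracialState M τ) {n : ℕ} {x : Fin n → M.toStarSubalgebra} (hx : Generates M x)
    (a : M.toStarSubalgebra) {δ : ℝ} (hδ : 0 < δ) :
    ∃ d ∈ StarAlgebra.adjoin ℂ (Set.range x), twoNorm τ (d - a) < δ := by
  obtain ⟨d, hd, hlt⟩ := hτ.dense hx
    ((StarAlgebra.adjoin ℂ (Set.range x)).map M.toStarSubalgebra.subtype)
    (by
      rintro _ ⟨j, rfl⟩
      exact ⟨x j, StarAlgebra.subset_adjoin ℂ _ ⟨j, rfl⟩, rfl⟩) a hδ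
  obtain ⟨d', hd', rfl⟩ := hd
  exact ⟨d', hd', hlt d'.2⟩

/-- In a hyperfinite von Neumann algebra, finitely many elements are simultaneously close to
elements of one finite-dimensional `*`-subalgebra. -/
lemma IsHyperfinite.exists_finiteDimensional {M : VonNeumannAlgebra H}
    {τ : M.toStarSubalgebra →ₗ[ℂ] ℂ} (hτ : IsNormalTracialState M τ) (hM : IsHyperfinite M)
    {n : ℕ} (x : Fin n → M.toStarSubalgebra) {δ : ℝ} (hδ : 0 < δ) :
    ∃ F : StarSubalgebra ℂ (H →L[ℂ] H), ∃ hF : F ≤ M.toStarSubalgebra, FiniteDimensional ℂ F ∧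
      ∀ j, ∃ d : F, twoNorm τ (StarSubalgebra.inclusion hF d - x j) < δ := by
  obtain ⟨𝓕, hne, hdir, hfd, hgen⟩ := hM
  have : Nonempty 𝓕 := hne.to_subtype
  have hdir' : Directed (· ≤ ·) (fun F : 𝓕 => (F : StarSubalgebra ℂ (H →L[ℂ] H))) :=
    directedOn_iff_directed.1 hdir
  have hD := StarSubalgebra.coe_iSup_of_directed hdir'
  have hsub : (⋃ F ∈ 𝓕, (F : Set (H →L[ℂ] H))) ⊆
      ((⨆ F : 𝓕, (F : StarSubalgebra ℂ (H →L[ℂ] H)) : StarSubalgebra ℂ (H →L[ℂ] H)) :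
        Set (H →L[ℂ] H)) := by
    rw [hD, Set.biUnion_eq_iUnion]
  have hex : ∀ j, ∃ F : 𝓕, ∃ d ∈ (F : StarSubalgebra ℂ (H →L[ℂ] H)),
      ∀ hd : d ∈ M.toStarSubalgebra, twoNorm τ (⟨d, hd⟩ - x j) < δ := by
    intro j
    obtain ⟨d, hd, hlt⟩ := hτ.dense hgen _ hsub (x j) hδ
    rw [← SetLike.mem_coe, hD, Set.mem_iUnion] at hd
    obtain ⟨F, hF⟩ := hd
    exact ⟨F, d, hF, hlt⟩
  choose G d hdG hd using hex
  obtain ⟨F, hF⟩ := hdir'.finite_le G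
  have hFM : (F : StarSubalgebra ℂ (H →L[ℂ] H)) ≤ M.toStarSubalgebra := fun a ha =>
    hgen.1 (Set.mem_biUnion F.2 ha)
  exact ⟨F, hFM, hfd F F.2, fun j => ⟨⟨d j, hF j (hdG j)⟩, hd j _⟩⟩

lemma isClosed_of_finiteDimensional (F : StarSubalgebra ℂ (H →L[ℂ] H))
    [FiniteDimensional ℂ F] : IsClosed (F : Set (H →L[ℂ] H)) := by
  have : FiniteDimensional ℂ (Subalgebra.toSubmodule F.toSubalgebra) :=
    inferInstanceAs (FiniteDimensional ℂ F)
  exact Submodule.closed_of_finiteDimensional (Subalgebra.toSubmodule F.toSubalgebra)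

lemma map_sum_smul {A B : Type*} [Ring A] [StarRing A] [Algebra ℂ A] [Ring B] [StarRing B]
    [Algebra ℂ B] (φ : A →⋆ₐ[ℂ] B) {I : Type*} [Fintype I] (c : I → I → ℂ) (v : I → A) :
    φ (∑ i, ∑ j, c i j • (v i * star (v j))) =
      ∑ i, ∑ j, c i j • (φ (v i) * star (φ (v j))) := by
  simp only [map_sum, map_smul, map_mul, map_star]

/-- An approximate column system persists along a net of representations with converging traces. -/
lemma IsApproxColumnSystem.eventually_map {M 𝒜 : Type*} [CStarAlgebra M] [CStarAlgebra 𝒜]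
    {τ : M →ₗ[ℂ] ℂ} {ι : Type*} {𝓛 : Filter ι} {K : ι → ℕ} {π : 𝒜 →⋆ₐ[ℂ] M}
    {φ : ∀ i, 𝒜 →⋆ₐ[ℂ] Matrix (Fin (K i + 1)) (Fin (K i + 1)) ℂ}
    (hev : ∀ b : 𝒜, ∀ t : ℝ, twoNorm τ (π b) < t →
      ∀ᶠ i in 𝓛, twoNorm (matTrace _) (φ i b) ≤ t)
    {I : Type*} [Fintype I] [DecidableEq I] {r : I → I} {a : I → 𝒜} (ha : ∀ j, ‖a j‖ ≤ 1)
    {η δ : ℝ} (hcol : IsApproxColumnSystem τ η r (fun j => π (a j))) (hηδ : η < δ) :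
    ∀ᶠ i in 𝓛, IsApproxColumnSystem (matTrace _) δ r (fun j => φ i (a j)) := by
  have e1 : ∀ (j j' : I), π (star (a j) * a j' - if j = j' then a (r j) else 0) =
      star (π (a j)) * π (a j') - if j = j' then π (a (r j)) else 0 := by
    intro j j'
    rw [map_sub, map_mul, map_star]; split_ifs <;> simp
  have e1' : ∀ i (j j' : I),
      φ i (star (a j) * a j' - if j = j' then a (r j) else 0) =
        star (φ i (a j)) * φ i (a j') - if j = j' then φ i (a (r j)) else 0 := by
    intro i j j'
    rw [map_sub, map_mul, map_star]; split_ifs <;> simp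
  have h1 : ∀ᶠ i in 𝓛, ∀ j j', twoNorm (matTrace _)
      (φ i (star (a j) * a j' - if j = j' then a (r j) else 0)) ≤ δ := by
    refine eventually_all.2 fun j => eventually_all.2 fun j' => hev _ _ ?_
    rw [e1]
    exact (hcol.star_mul j j').trans_lt hηδ
  have h2 : ∀ᶠ i in 𝓛, ∀ j, twoNorm (matTrace _) (φ i (a j * a (r j) - a j)) ≤ δ := by
    refine eventually_all.2 fun j => hev _ _ ?_
    rw [map_sub, map_mul]
    exact (hcol.mul_rep j).trans_lt hηδ
  have h3 : ∀ᶠ i in 𝓛, twoNorm (matTrace _) (φ i (∑ j, a j * star (a j) - 1)) ≤ δ := by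
    refine hev _ _ ?_
    simp only [map_sub, map_sum, map_mul, map_star, map_one]
    exact hcol.sum.trans_lt hηδ
  filter_upwards [h1, h2, h3] with i g1 g2 g3
  refine ⟨fun j => (NonUnitalStarAlgHom.norm_apply_le (φ i) (a j)).trans (ha j), fun j j' => ?_,
    fun j => ?_, ?_⟩
  · have := g1 j j'
    rwa [e1'] at this
  · have := g2 j
    rwa [map_sub, map_mul] at this
  · simp only [map_sub, map_sum, map_mul, map_star, map_one] at g3
    exact g3

/-- Two sequences of microstates of generators of a hyperfinite algebra, with improving accuracy,
have a pair of terms of equal size in one orbit-ball. -/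
lemma exists_mem_orbitBall_of_microstates {M : VonNeumannAlgebra H}
    {τ : M.toStarSubalgebra →ₗ[ℂ] ℂ} (hτ : IsNormalTracialState M τ) (hM : IsHyperfinite M)
    {n : ℕ} {x : Fin n → M.toStarSubalgebra} (hx : Generates M x) {R ω : ℝ} (hω : 0 < ω)
    (K : ℕ → ℕ) (A : ∀ (l : ℕ) (_ : Bool), Fin n → Matrix (Fin (K l + 1)) (Fin (K l + 1)) ℂ)
    (hA : ∀ l b, A l b ∈ microstates τ x R l (K l + 1) (1 / ((l : ℝ) + 1))) :
    ∃ l, A l true ∈ orbitBall (A l false) ω := by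
  have hτ' := hτ.isTracialState
  set ρ : ℝ := ω / (4 * (n + 1)) with hρ
  have hρ0 : 0 < ρ := by positivity
  -- Coefficients of the generators in a column system of a finite-dimensional subalgebra.
  obtain ⟨F, hF, hfd, hd⟩ := hM.exists_finiteDimensional hτ x (half_pos hρ0)
  choose d hd using hd
  have hFc : IsClosed (F : Set (H →L[ℂ] H)) := isClosed_of_finiteDimensional F
  obtain ⟨N, r, v₀, hv₀, hspan⟩ := exists_columnSystem F
  choose c hc hdc using fun j => hspan (d j)
  have hv := hv₀.map (StarSubalgebra.inclusion hF)
  set v : Fin N → M.toStarSubalgebra := fun i => StarSubalgebra.inclusion hF (v₀ i) with hvdef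
  have hxv : ∀ j, twoNorm τ (x j - ∑ i, ∑ i', c j i i' • (v i * star (v i'))) < ρ / 2 := by
    intro j
    have h1 : StarSubalgebra.inclusion hF (d j) =
        ∑ i, ∑ i', c j i i' • (v i * star (v i')) := by
      rw [hdc j, map_sum_smul]
    rw [← h1, hτ'.sub_comm]
    exact hd j
  obtain ⟨δ, hδ, horb⟩ := exists_mem_orbitBall hv.idem c hc hω
  -- The C*-algebra generated by the microstates.
  let 𝓛 : Filter (ℕ × Bool) := comap Prod.fst atTop
  have hlim : ∀ w, Tendsto (fun i : ℕ × Bool => matTrace _ (starWord (A i.1 i.2) w)) 𝓛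
      (𝓝 (τ (starWord x w))) := by
    intro w
    rcases Nat.eq_zero_or_pos w.length with h0 | h0
    · rw [List.length_eq_zero_iff] at h0
      subst h0
      simp only [starWord_nil, hτ'.map_one,
        (isTracialState_matTrace (Nat.le_add_left 1 _)).map_one]
      exact tendsto_const_nhds
    · rw [tendsto_iff_norm_sub_tendsto_zero]
      have h1 : Tendsto (fun i : ℕ × Bool => 1 / ((i.1 : ℝ) + 1)) 𝓛 (𝓝 0) :=
        tendsto_one_div_add_atTop_nhds_zero_nat.comp tendsto_comap
      refine squeeze_zero' (Eventually.of_forall fun i => norm_nonneg _) ?_ h1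
      have h2 : ∀ᶠ i : ℕ × Bool in 𝓛, w.length ≤ i.1 := tendsto_comap.eventually_ge_atTop _
      filter_upwards [h2] with i hi
      exact ((hA i.1 i.2).2 w h0 hi).le
  -- The operator norm `opNorm` is by definition the norm of the matrix C*-algebra.
  obtain ⟨𝒜, _, π, φ, y, hπy, hφy, hconv⟩ := exists_limit_model hτ' x 𝓛 (fun i => K i.1)
    (fun i => A i.1 i.2) R (fun i j => (hA i.1 i.2).1 j) hlim
  have hdense : ∀ a : M.toStarSubalgebra, ∀ ε > 0, ∃ b : 𝒜, twoNorm τ (π b - a) < ε := by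
    intro a ε hε
    obtain ⟨d, hd, hlt⟩ := hx.exists_adjoin_dense hτ a hε
    have h1 : StarAlgebra.adjoin ℂ (Set.range x) ≤ π.range :=
      StarAlgebra.adjoin_le (by rintro _ ⟨j, rfl⟩; exact ⟨y j, hπy j⟩)
    obtain ⟨b, rfl⟩ := h1 hd
    exact ⟨b, hlt⟩
  -- Lift the column system to contractions of that algebra.
  set C : ℝ := ∑ j, ∑ i, ∑ i', ‖c j i i'‖ with hC
  have hC0 : 0 ≤ C := by positivity
  set κ : ℝ := min (δ / (2 * (2 * N + 3))) (ρ / (8 * (C + 1))) with hκ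
  have hκ0 : 0 < κ := lt_min (by positivity) (by positivity)
  have hκδ : (2 * N + 3) * κ < δ := by
    have : κ * (2 * (2 * N + 3)) ≤ δ := by
      rw [← le_div_iff₀ (by positivity)]; exact min_le_left _ _
    nlinarith
  have hκρ : C * (2 * κ) < ρ / 2 := by
    have : κ * (8 * (C + 1)) ≤ ρ := by
      rw [← le_div_iff₀ (by positivity)]; exact min_le_right _ _
    nlinarith
  choose a han ha using fun i => hτ'.exists_norm_le_one π hdense (hv.norm_le i) hκ0
  have hπa : ∀ i, ‖π (a i)‖ ≤ 1 := fun i =>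
    (NonUnitalStarAlgHom.norm_apply_le π (a i)).trans (han i)
  have hcol := hv.approx hτ' hπa (fun i => (ha i).le) hκ0.le
  simp only [Fintype.card_fin] at hcol
  -- All relations hold in the matrix algebras at late stages.
  have hev : ∀ b : 𝒜, ∀ t : ℝ, twoNorm τ (π b) < t →
      ∀ᶠ i in 𝓛, twoNorm (matTrace _) (φ i b) ≤ t := fun b t hbt =>
    ((tendsto_twoNorm hconv b).eventually_lt_const hbt).mono fun i hi => hi.le
  have hcolev : ∀ᶠ i in 𝓛, IsApproxColumnSystem (matTrace _) δ r (fun j => φ i (a j)) :=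
    hcol.eventually_map hev han hκδ
  have hspanev : ∀ᶠ i in 𝓛, ∀ j, twoNorm (matTrace _) (A i.1 i.2 j -
      ∑ k, ∑ k', c j k k' • (φ i (a k) * star (φ i (a k')))) ≤ ρ := by
    refine eventually_all.2 fun j => ?_
    have h1 : twoNorm τ (π (y j - ∑ k, ∑ k', c j k k' • (a k * star (a k')))) < ρ := by
      have h2 := hv.twoNorm_sum_smul_sub_le hτ' hπa (fun i => (ha i).le) (c j)
      have hCj : ∑ i, ∑ i', ‖c j i i'‖ ≤ C :=
        Finset.single_le_sum (f := fun j => ∑ i, ∑ i', ‖c j i i'‖)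
          (fun _ _ => by positivity) (Finset.mem_univ j)
      have h3 : (∑ i, ∑ i', ‖c j i i'‖) * (2 * κ) ≤ C * (2 * κ) :=
        mul_le_mul_of_nonneg_right hCj (by positivity)
      have h4 := hτ'.triangle (x j) (∑ i, ∑ i', c j i i' • (v i * star (v i')))
        (∑ k, ∑ k', c j k k' • (π (a k) * star (π (a k'))))
      have h5 : π (y j - ∑ k, ∑ k', c j k k' • (a k * star (a k'))) =
          x j - ∑ k, ∑ k', c j k k' • (π (a k) * star (π (a k'))) := by
        rw [map_sub, map_sum_smul, hπy]
      rw [h5]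
      linarith [hxv j]
    filter_upwards [hev _ _ h1] with i hi
    rw [map_sub, map_sum_smul, hφy] at hi
    exact hi
  have htrev : ∀ᶠ i in 𝓛, ∀ j, ‖matTrace _ (φ i (a j)) - τ (π (a j))‖ ≤ δ / 2 := by
    refine eventually_all.2 fun j => ?_
    filter_upwards [Metric.tendsto_nhds.1 (hconv (a j)) (δ / 2) (half_pos hδ)] with i hi
    rw [dist_eq_norm] at hi
    exact hi.le
  obtain ⟨l, hl⟩ := (eventually_comap.1 (hcolev.and (hspanev.and htrev))).exists
  obtain ⟨c1, s1, t1⟩ := hl (l, true) rfl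
  obtain ⟨c2, s2, t2⟩ := hl (l, false) rfl
  refine ⟨l, horb (K l + 1) (Nat.le_add_left 1 _) (A l true) (A l false)
    (fun j => φ (l, true) (a j)) (fun j => φ (l, false) (a j)) c1 c2 (fun i => ?_) s1 s2⟩
  have h1 := norm_sub_le (matTrace (K l + 1) (φ (l, true) (a (r i))) - τ (π (a (r i))))
    (matTrace (K l + 1) (φ (l, false) (a (r i))) - τ (π (a (r i))))
  rw [sub_sub_sub_cancel_right] at h1
  have h2 := t1 (r i)
  have h3 := t2 (r i)
  dsimp only at h1 h2 h3 ⊢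
  linarith

/-- Any two sufficiently accurate microstates of generators of a hyperfinite algebra are conjugate
up to `ω`, uniformly in the size of the matrices. -/
lemma exists_forall_mem_orbitBall {M : VonNeumannAlgebra H} {τ : M.toStarSubalgebra →ₗ[ℂ] ℂ}
    (hτ : IsNormalTracialState M τ) (hM : IsHyperfinite M) {n : ℕ}
    {x : Fin n → M.toStarSubalgebra} (hx : Generates M x) (R : ℝ) {ω : ℝ} (hω : 0 < ω) :
    ∃ (m : ℕ) (ε : ℝ), 0 < ε ∧ ∀ k, 1 ≤ k → ∀ A ∈ microstates τ x R m k ε,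
      ∀ B ∈ microstates τ x R m k ε, A ∈ orbitBall B ω := by
  by_contra! hcon
  have h1 : ∀ l : ℕ, ∃ K : ℕ, ∃ A : Bool → Fin n → Matrix (Fin (K + 1)) (Fin (K + 1)) ℂ,
      (∀ b, A b ∈ microstates τ x R l (K + 1) (1 / ((l : ℝ) + 1))) ∧
      A true ∉ orbitBall (A false) ω := by
    intro l
    obtain ⟨k, hk, A, hA, B, hB, hAB⟩ := hcon l (1 / ((l : ℝ) + 1)) (by positivity)
    obtain ⟨K, rfl⟩ := Nat.exists_eq_add_of_le' hk
    exact ⟨K, fun b => bif b then A else B, Bool.forall_bool.2 ⟨hB, hA⟩, hAB⟩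
  choose K A hA hAB using h1
  obtain ⟨l, hl⟩ := exists_mem_orbitBall_of_microstates hτ hM hx hω K A hA
  exact hAB l hl

end Uniqueness

/-! ### Matrix representations of finite-dimensional tracial algebras -/

namespace IsTracialState

lemma map_star {A : Type*} [CStarAlgebra A] {τ : A →ₗ[ℂ] ℂ} (hτ : IsTracialState τ) (a : A) :
    τ (star a) = star (τ a) := by
  let := CStarAlgebra.spectralOrder A
  have := CStarAlgebra.spectralOrderedRing A
  have hpos : ∀ a, 0 ≤ a → 0 ≤ τ a := by
    intro a ha
    obtain ⟨b, rfl⟩ := CStarAlgebra.nonneg_iff_eq_star_mul_self.1 ha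
    exact hτ.nonneg b
  exact StarHomClass.map_star (PositiveLinearMap.mk₀ τ hpos) a

end IsTracialState

/-- The matrix entries `c_ij` of `a` for the matrix units `v_i v_j*`, read off from
`v_i* a v_j = c_ij v_{r i}` by a trace. They vanish by the convention `z / 0 = 0` on the blocks of
trace zero. -/
def blockCoeff {F : Type*} [CStarAlgebra F] {I : Type*} (σ : F →ₗ[ℂ] ℂ) (r : I → I) (v : I → F)
    (a : F) (i j : I) : ℂ :=
  σ (star (v i) * a * v j) / σ (v (r i))

section BlockCoeff

variable {F : Type*} [CStarAlgebra F] {I : Type*} [Fintype I] [DecidableEq I] {σ : F →ₗ[ℂ] ℂ}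
  {r : I → I} {v : I → F}

lemma IsColumnSystem.exists_star_mul_mul (h : IsColumnSystem r v) {a : F} {c : I → I → ℂ}
    (hc : ∀ i j, r i ≠ r j → c i j = 0) (ha : a = ∑ i, ∑ j, c i j • (v i * star (v j))) (i j : I) :
    star (v i) * a * v j = c i j • v (r i) := by
  have h1 : ∀ k l, star (v i) * (c k l • (v k * star (v l))) * v j =
      if k = i ∧ l = j then c i j • (v (r i) * v (r j)) else 0 := by
    intro k l
    have e : star (v i) * (c k l • (v k * star (v l))) * v j =
        c k l • ((star (v i) * v k) * (star (v l) * v j)) := by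
      simp only [mul_smul_comm, smul_mul_assoc, mul_assoc]
    rw [e, h.star_mul, h.star_mul]
    by_cases hk : k = i <;> by_cases hl : l = j <;> simp [hk, hl, eq_comm]
    intro hh; exact absurd hh.symm hk
  rw [ha]
  simp only [Finset.mul_sum, Finset.sum_mul, h1]
  rw [Finset.sum_eq_single i, Finset.sum_eq_single j]
  · rw [if_pos ⟨rfl, rfl⟩]
    by_cases hr : r i = r j
    · rw [← hr, h.rep_mul_rep]
    · rw [hc i j hr, zero_smul, zero_smul]
  · intro l _ hl; rw [if_neg (by tauto)]
  · simp
  · intro k _ hk; exact Finset.sum_eq_zero fun l _ => by rw [if_neg (by tauto)]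
  · simp

variable (h : IsColumnSystem r v)
  (hspan : ∀ a : F, ∃ c : I → I → ℂ, (∀ i j, r i ≠ r j → c i j = 0) ∧
    a = ∑ i, ∑ j, c i j • (v i * star (v j)))
include h hspan

lemma blockCoeff_smul (a : F) (i j : I) (hi : σ (v (r i)) ≠ 0) :
    star (v i) * a * v j = blockCoeff σ r v a i j • v (r i) := by
  obtain ⟨c, hc, hac⟩ := hspan a
  have h1 := h.exists_star_mul_mul hc hac i j
  rw [blockCoeff, h1, map_smul, smul_eq_mul, mul_div_cancel_right₀ _ hi]

lemma blockCoeff_eq_zero (a : F) {i j : I} (hij : r i ≠ r j) : blockCoeff σ r v a i j = 0 := by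
  obtain ⟨c, hc, hac⟩ := hspan a
  rw [blockCoeff, h.exists_star_mul_mul hc hac i j, hc i j hij, zero_smul, map_zero, zero_div]

lemma blockCoeff_mul (a b : F) (i j : I) :
    blockCoeff σ r v (a * b) i j = ∑ p, blockCoeff σ r v a i p * blockCoeff σ r v b p j := by
  by_cases hi : σ (v (r i)) = 0
  · simp [blockCoeff, hi]
  have h1 : star (v i) * (a * b) * v j =
      ∑ p, (star (v i) * a * v p) * (star (v p) * b * v j) := by
    calc star (v i) * (a * b) * v j
        = star (v i) * a * (∑ p, v p * star (v p)) * (b * v j) := by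
          rw [h.sum]; noncomm_ring
      _ = _ := by
          simp only [Finset.mul_sum, Finset.sum_mul]
          exact Finset.sum_congr rfl fun p _ => by noncomm_ring
  have h2 : ∀ p, (star (v i) * a * v p) * (star (v p) * b * v j) =
      (blockCoeff σ r v a i p * blockCoeff σ r v b p j) • v (r i) := by
    intro p
    rw [blockCoeff_smul h hspan a i p hi]
    by_cases hp : r i = r p
    · rw [blockCoeff_smul h hspan b p j (hp ▸ hi), ← hp, smul_mul_smul_comm, h.rep_mul_rep]
    · rw [blockCoeff_eq_zero h hspan a hp]; simp
  rw [blockCoeff, h1, Finset.sum_congr rfl fun p _ => h2 p, ← Finset.sum_smul, map_smul,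
    smul_eq_mul, mul_div_cancel_right₀ _ hi]

lemma blockCoeff_star (hσ : IsTracialState σ) (a : F) (i j : I) :
    blockCoeff σ r v (star a) i j = star (blockCoeff σ r v a j i) := by
  by_cases hij : r i = r j
  · have h1 : star (v i) * star a * v j = star (star (v j) * a * v i) := by
      simp [mul_assoc]
    have h2 : σ (v (r i)) = star (σ (v (r i))) := by
      rw [← hσ.map_star, h.star_rep]
    rw [blockCoeff, blockCoeff, h1, hσ.map_star, star_div₀, ← hij, ← h2]
  · rw [blockCoeff_eq_zero h hspan _ hij, blockCoeff_eq_zero h hspan _ (Ne.symm hij), star_zero]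

lemma sum_blockCoeff (hσ : IsTracialState σ) (a : F) :
    ∑ i, blockCoeff σ r v a i i * σ (v (r i)) = σ a := by
  have h1 : σ a = ∑ i, σ (star (v i) * a * v i) := by
    calc σ a = σ ((∑ i, v i * star (v i)) * a) := by rw [h.sum, one_mul]
      _ = _ := by
        rw [Finset.sum_mul, map_sum]
        exact Finset.sum_congr rfl fun i _ => by rw [mul_assoc, hσ.trace]
  rw [h1]
  refine Finset.sum_congr rfl fun i _ => ?_
  by_cases hi : σ (v (r i)) = 0
  · obtain ⟨c, hc, hac⟩ := hspan a
    rw [h.exists_star_mul_mul hc hac, map_smul, hi, smul_zero, mul_zero]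
  · rw [blockCoeff_smul h hspan a i i hi, map_smul, smul_eq_mul]

end BlockCoeff

/-- The partial permutation matrix that sends the `q`-th basis vector, for `q < m`, to the `e q`-th
one, and the other basis vectors to zero. -/
def shiftMatrix {k m : ℕ} (e : Fin m → Fin k) : Matrix (Fin k) (Fin k) ℂ :=
  Matrix.of fun p q => if h : q.1 < m then (if p = e ⟨q, h⟩ then 1 else 0) else 0

/-- The projection onto the first `m` basis vectors. -/
def cutoffMatrix (k m : ℕ) : Matrix (Fin k) (Fin k) ℂ :=
  Matrix.diagonal fun q => if q.1 < m then 1 else 0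

lemma shiftMatrix_mul_cutoffMatrix {k m : ℕ} (e : Fin m → Fin k) :
    shiftMatrix e * cutoffMatrix k m = shiftMatrix e := by
  ext p q
  rw [cutoffMatrix, Matrix.mul_diagonal]
  by_cases h : q.1 < m <;> simp [shiftMatrix, h]

lemma star_shiftMatrix_mul {k m l : ℕ} (e : Fin m → Fin k) (f : Fin l → Fin k)
    (hef : ∀ i j, e i ≠ f j) : star (shiftMatrix e) * shiftMatrix f = 0 := by
  ext p q
  rw [Matrix.mul_apply]
  refine Finset.sum_eq_zero fun s _ => ?_
  simp only [shiftMatrix, Matrix.star_apply, Matrix.of_apply]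
  split_ifs with h1 h2 h3 h4 <;> simp_all
  exact absurd ‹_› (hef _ _ ∘ Eq.symm)

lemma star_shiftMatrix_mul_self {k m : ℕ} (e : Fin m → Fin k) (he : Function.Injective e) :
    star (shiftMatrix e) * shiftMatrix e = cutoffMatrix k m := by
  ext p q
  rw [Matrix.mul_apply, cutoffMatrix, Matrix.diagonal_apply]
  simp only [shiftMatrix, Matrix.star_apply, Matrix.of_apply]
  by_cases hq : q.1 < m
  · by_cases hp : p.1 < m
    · simp only [hp, hq, dif_pos]
      rw [Finset.sum_eq_single (e ⟨q, hq⟩)]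
      · by_cases hpq : p = q
        · subst hpq; simp
        · have : e ⟨q, hq⟩ ≠ e ⟨p, hp⟩ := fun hh => hpq (by
            have := he hh; simp only [Fin.mk.injEq] at this; exact Fin.ext this.symm)
          simp [hpq, this]
      · intro s _ hs; simp [hs]
      · simp
    · have : p ≠ q := fun hh => hp (hh ▸ hq)
      simp [hp, this]
  · by_cases hpq : p = q
    · subst hpq; simp [hq]
    · simp [hq, hpq]

lemma trace_cutoffMatrix {k m : ℕ} (hm : m ≤ k) : (cutoffMatrix k m).trace = m := by
  rw [cutoffMatrix, Matrix.trace_diagonal, Fin.sum_univ_eq_sum_range (fun q => if q < m then (1:ℂ) else 0),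
    Finset.sum_ite, Finset.sum_const_zero, add_zero, Finset.sum_const, nsmul_eq_mul, mul_one]
  congr 1
  have : (Finset.range k).filter (fun q => q < m) = Finset.range m := by
    ext q; simp only [Finset.mem_filter, Finset.mem_range]; omega
  rw [this, Finset.card_range]

/-- Shift matrices with disjoint ranges exist as long as the ranks add up to at most `k`. -/
lemma exists_shiftMatrices {k : ℕ} {I : Type*} [Fintype I] [DecidableEq I] (m : I → ℕ)
    (hm : ∑ i, m i ≤ k) : ∃ V : I → Matrix (Fin k) (Fin k) ℂ,
      (∀ i, star (V i) * V i = cutoffMatrix k (m i)) ∧ (∀ i j, i ≠ j → star (V i) * V j = 0) ∧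
      ∀ i, V i * cutoffMatrix k (m i) = V i := by
  have hcard : Fintype.card (Σ i, Fin (m i)) ≤ Fintype.card (Fin k) := by
    simpa using hm
  obtain ⟨e⟩ := Function.Embedding.nonempty_of_card_le hcard
  refine ⟨fun i => shiftMatrix fun α : Fin (m i) => e ⟨i, α⟩, fun i => ?_, fun i j hij => ?_,
    fun i => shiftMatrix_mul_cutoffMatrix _⟩
  · refine star_shiftMatrix_mul_self _ fun α β hαβ => ?_
    simpa using e.injective hαβ
  · refine star_shiftMatrix_mul _ _ fun α β hαβ => hij ?_
    exact congrArg Sigma.fst (e.injective hαβ)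

/-- A finite-dimensional C*-algebra with a column system acts on `ℂ^k` with the multiplicities
`m (r i)`. -/
lemma exists_blockRepresentation {F : Type*} [CStarAlgebra F] {I : Type*} [Fintype I]
    [DecidableEq I] {σ : F →ₗ[ℂ] ℂ} (hσ : IsTracialState σ) {r : I → I} {v : I → F}
    (h : IsColumnSystem r v)
    (hspan : ∀ a : F, ∃ c : I → I → ℂ, (∀ i j, r i ≠ r j → c i j = 0) ∧
      a = ∑ i, ∑ j, c i j • (v i * star (v j)))
    {k : ℕ} (m : I → ℕ) (hm : ∑ i, m (r i) ≤ k) :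
    ∃ π : F →⋆ₙₐ[ℂ] Matrix (Fin k) (Fin k) ℂ, ∀ a,
      matTrace k (π a) = ∑ i, blockCoeff σ r v a i i * ((m (r i) : ℂ) / k) := by
  obtain ⟨V, hV1, hV2, hV3⟩ := exists_shiftMatrices (fun i => m (r i)) hm
  let f : F → Matrix (Fin k) (Fin k) ℂ := fun a =>
    ∑ i, ∑ j, blockCoeff σ r v a i j • (V i * star (V j))
  have hadd : ∀ a b i j, blockCoeff σ r v (a + b) i j =
      blockCoeff σ r v a i j + blockCoeff σ r v b i j := fun a b i j => by
    simp [blockCoeff, mul_add, add_mul, add_div]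
  have hsmul : ∀ (c : ℂ) a i j, blockCoeff σ r v (c • a) i j = c * blockCoeff σ r v a i j :=
    fun c a i j => by simp [blockCoeff, mul_div_assoc]
  let π : F →⋆ₙₐ[ℂ] Matrix (Fin k) (Fin k) ℂ :=
    { toFun := f
      map_smul' := fun c a => by
        simp only [f, hsmul, Finset.smul_sum, smul_smul, MonoidHom.id_apply]
      map_zero' := by simp [f, blockCoeff]
      map_add' := fun a b => by
        simp only [f, hadd, add_smul, Finset.sum_add_distrib]
      map_mul' := fun a b => by
        have h1 : ∀ i p q j, (blockCoeff σ r v a i p • (V i * star (V p))) *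
            (blockCoeff σ r v b q j • (V q * star (V j))) =
            if p = q then (blockCoeff σ r v a i p * blockCoeff σ r v b p j) • (V i * star (V j))
            else 0 := by
          intro i p q j
          have e : (V i * star (V p)) * (V q * star (V j)) =
              V i * (star (V p) * V q) * star (V j) := by noncomm_ring
          rw [smul_mul_smul_comm, e]
          split_ifs with hpq
          · subst hpq
            by_cases hip : r i = r p
            · rw [hV1, ← hip, hV3]
            · rw [blockCoeff_eq_zero h hspan a hip]; simp
          · rw [hV2 p q hpq]; simp
        simp only [f, Finset.sum_mul, blockCoeff_mul h hspan a b, Finset.sum_smul]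
        refine Finset.sum_congr rfl fun i _ => ?_
        rw [Finset.sum_comm]
        refine Finset.sum_congr rfl fun p _ => ?_
        simp only [Finset.mul_sum, h1]
        refine Eq.symm ((Finset.sum_eq_single p (fun q _ hq => ?_) (by simp)).trans (by simp))
        simp [hq.symm]
      map_star' := fun a => by
        simp only [f, star_sum, star_smul, star_mul, star_star, blockCoeff_star h hspan hσ]
        rw [Finset.sum_comm] }
  refine ⟨π, fun a => ?_⟩
  change matTrace k (∑ i, ∑ j, blockCoeff σ r v a i j • (V i * star (V j))) = _
  simp only [map_sum, map_smul]
  refine Finset.sum_congr rfl fun i _ => ?_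
  have hmk : m (r i) ≤ k :=
    (Finset.single_le_sum (f := fun i => m (r i)) (fun _ _ => Nat.zero_le _)
      (Finset.mem_univ i)).trans hm
  rw [Finset.sum_eq_single i]
  · rw [matTrace_apply, normTrace, Matrix.trace_mul_comm, hV1, trace_cutoffMatrix hmk, smul_eq_mul,
      div_eq_inv_mul]
  · intro j _ hj
    rw [matTrace_apply, normTrace, Matrix.trace_mul_comm, hV2 j i hj, Matrix.trace_zero, mul_zero,
      smul_zero]
  · simp

/-- A tracial state on a finite-dimensional C*-algebra is a limit of normalized traces composed with
(not necessarily unital) representations in all sizes. -/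
lemma exists_representations {F : Type*} [CStarAlgebra F] [FiniteDimensional ℂ F] {σ : F →ₗ[ℂ] ℂ}
    (hσ : IsTracialState σ) :
    ∃ π : ∀ k : ℕ, F →⋆ₙₐ[ℂ] Matrix (Fin k) (Fin k) ℂ,
      ∀ a, Tendsto (fun k => matTrace k (π k a)) atTop (𝓝 (σ a)) := by
  obtain ⟨N, r, v, h, hspan⟩ := exists_columnSystem F
  set t : Fin N → ℝ := fun i => (σ (v i)).re with ht
  have hreal : ∀ i, σ (v (r i)) = (t (r i) : ℂ) := fun i => by
    have h1 : star (σ (v (r i))) = σ (v (r i)) := by rw [← hσ.map_star, h.star_rep]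
    exact (Complex.conj_eq_iff_re.1 h1).symm
  have htpos : ∀ i, 0 ≤ t (r i) := fun i => by
    have h1 := hσ.nonneg (v i)
    rw [h.star_mul_self, hreal] at h1
    exact_mod_cast h1
  have hsum : ∑ i, t (r i) = 1 := by
    have h1 : ∑ i, σ (v (r i)) = 1 := by
      rw [← hσ.map_one, ← h.sum, map_sum]
      exact Finset.sum_congr rfl fun i _ => by rw [hσ.trace, h.star_mul_self]
    simp only [hreal] at h1
    exact_mod_cast h1
  have hm : ∀ k : ℕ, ∑ i, ⌊t (r i) * k⌋₊ ≤ k := by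
    intro k
    have h1 : ((∑ i, ⌊t (r i) * k⌋₊ : ℕ) : ℝ) ≤ k := by
      push_cast
      calc ∑ i, (⌊t (r i) * k⌋₊ : ℝ) ≤ ∑ i, t (r i) * k :=
            Finset.sum_le_sum fun i _ =>
              Nat.floor_le (mul_nonneg (htpos i) (Nat.cast_nonneg k))
        _ = k := by rw [← Finset.sum_mul, hsum, one_mul]
    exact_mod_cast h1
  choose π hπ using fun k : ℕ =>
    exists_blockRepresentation hσ h hspan (fun i => ⌊t i * k⌋₊) (hm k)
  refine ⟨π, fun a => ?_⟩
  simp only [hπ]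
  rw [← sum_blockCoeff h hspan hσ a]
  refine tendsto_finsetSum _ fun i _ => Tendsto.const_mul _ ?_
  rw [hreal]
  have h1 := (tendsto_nat_floor_mul_div_atTop (htpos i)).comp (tendsto_natCast_atTop_atTop (R := ℝ))
  have h2 := (Complex.continuous_ofReal.tendsto _).comp h1
  refine h2.congr fun k => ?_
  simp

/-! ### Existence of microstates -/

lemma map_starWord_of_ne_nil {A B : Type*} [CStarAlgebra A] [CStarAlgebra B] (φ : A →⋆ₙₐ[ℂ] B)
    {n : ℕ} (x : Fin n → A) {w : List (Fin n × Bool)} (hw : w ≠ []) :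
    φ (starWord x w) = starWord (fun j => φ (x j)) w := by
  have hl : ∀ p : Fin n × Bool, φ (if p.2 then star (x p.1) else x p.1) =
      if p.2 then star (φ (x p.1)) else φ (x p.1) := fun p => by
    split_ifs
    · exact map_star φ _
    · rfl
  induction w with
  | nil => exact absurd rfl hw
  | cons p w ih =>
    rcases eq_or_ne w [] with rfl | hw'
    · simpa [starWord] using hl p
    · have h1 := ih hw'
      simp only [starWord, List.map_cons, List.prod_cons, map_mul] at h1 ⊢
      rw [h1, hl p]

lemma norm_starWord_le {A : Type*} [CStarAlgebra A] {n : ℕ} {x : Fin n → A} {S : ℝ}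
    (hx : ∀ j, ‖x j‖ ≤ S) (w : List (Fin n × Bool)) : ‖starWord x w‖ ≤ S ^ w.length := by
  induction w with
  | nil => simpa [starWord] using norm_le_one_of_mem_unitary (one_mem (unitary A))
  | cons p w ih =>
    have hp : ‖if p.2 then star (x p.1) else x p.1‖ ≤ S := by split_ifs <;> simp [hx]
    simp only [starWord, List.map_cons, List.prod_cons, List.length_cons, pow_succ'] at ih ⊢
    exact (norm_mul_le _ _).trans
      (mul_le_mul hp ih (norm_nonneg _) ((norm_nonneg _).trans hp))

/-- On bounded tuples, `*`-words are Lipschitz for `‖·‖₂`. -/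
lemma IsTracialState.twoNorm_starWord_sub_le {A : Type*} [CStarAlgebra A] {τ : A →ₗ[ℂ] ℂ}
    (hτ : IsTracialState τ) {n : ℕ} {x y : Fin n → A} {S δ : ℝ} (hS : 1 ≤ S) (hδ : 0 ≤ δ)
    (hx : ∀ j, ‖x j‖ ≤ S) (hy : ∀ j, ‖y j‖ ≤ S) (hxy : ∀ j, twoNorm τ (x j - y j) ≤ δ)
    (w : List (Fin n × Bool)) :
    twoNorm τ (starWord x w - starWord y w) ≤ w.length * (S ^ w.length * δ) := by
  induction w with
  | nil => simp [starWord, twoNorm_zero]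
  | cons p w ih =>
    have hp : ‖if p.2 then star (y p.1) else y p.1‖ ≤ S := by split_ifs <;> simp [hy]
    have hpd : twoNorm τ ((if p.2 then star (x p.1) else x p.1) -
        if p.2 then star (y p.1) else y p.1) ≤ δ := by
      split_ifs
      · rw [← star_sub, hτ.twoNorm_star]; exact hxy _
      · exact hxy _
    have hw := norm_starWord_le hx w
    simp only [starWord, List.map_cons, List.prod_cons, List.length_cons] at ih hw ⊢
    set a := if p.2 then star (x p.1) else x p.1
    set b := if p.2 then star (y p.1) else y p.1
    set u := (w.map fun p => if p.2 then star (x p.1) else x p.1).prod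
    set u' := (w.map fun p => if p.2 then star (y p.1) else y p.1).prod
    have e : a * u - b * u' = (a - b) * u + b * (u - u') := by noncomm_ring
    have hSq : 0 ≤ S ^ w.length := by positivity
    have h1 : twoNorm τ ((a - b) * u) ≤ δ * S ^ w.length :=
      (hτ.mul_le_right _ _).trans (mul_le_mul hpd hw (norm_nonneg _) hδ)
    have h2 : twoNorm τ (b * (u - u')) ≤ S * (w.length * (S ^ w.length * δ)) :=
      (hτ.mul_le_left _ _).trans (mul_le_mul hp ih (twoNorm_nonneg _ _) (by linarith))
    have h3 : δ * S ^ w.length ≤ S * (δ * S ^ w.length) :=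
      le_mul_of_one_le_left (mul_nonneg hδ hSq) hS
    rw [e]
    refine (hτ.add_le _ _).trans ((add_le_add (h1.trans h3) h2).trans (le_of_eq ?_))
    push_cast
    ring

section Existence

variable {H : Type*} [NormedAddCommGroup H] [InnerProductSpace ℂ H] [CompleteSpace H]

/-- Tuples in a hyperfinite von Neumann algebra have microstates of all large sizes, with any
cutoff that bounds their norms. -/
lemma eventually_nonempty_microstates {M : VonNeumannAlgebra H} {τ : M.toStarSubalgebra →ₗ[ℂ] ℂ}
    (hτ : IsNormalTracialState M τ) (hM : IsHyperfinite M) {n : ℕ}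
    {x : Fin n → M.toStarSubalgebra} {R : ℝ} (hR : 0 < R) (hx : ∀ j, ‖x j‖ ≤ R) (m : ℕ) {ε : ℝ}
    (hε : 0 < ε) : ∀ᶠ k : ℕ in atTop, (microstates τ x R m k ε).Nonempty := by
  have hτ' := hτ.isTracialState
  have hnR : ‖(R : ℂ)‖ = R := by rw [Complex.norm_real, Real.norm_of_nonneg hR.le]
  have hRC : (R : ℂ) ≠ 0 := by exact_mod_cast hR.ne'
  set S : ℝ := max R 1 with hS
  have hS1 : 1 ≤ S := le_max_right _ _
  have hRS : R ≤ S := le_max_left _ _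
  set δ : ℝ := ε / (2 * (m + 1) * S ^ m) with hδ
  have hδ0 : 0 < δ := by positivity
  -- Approximate the generators by elements of a finite-dimensional subalgebra, without exceeding
  -- the norm bound `R`.
  have hy : ∀ j, ∃ y, truncate y = (R : ℂ)⁻¹ • x j := fun j => exists_truncate_eq (by
    rw [norm_smul, norm_inv, hnR, inv_mul_le_iff₀ hR, mul_one]; exact hx j)
  choose y hy using hy
  obtain ⟨F, hF, hfd, hd⟩ := hM.exists_finiteDimensional hτ y (δ := δ / (3 * R)) (by positivity)
  choose d hd using hd
  have hFc : IsClosed (F : Set (H →L[ℂ] H)) := isClosed_of_finiteDimensional F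
  let ι := StarSubalgebra.inclusion hF
  let b : Fin n → F := fun j => (R : ℂ) • truncate (d j)
  have hb : ∀ j, ‖b j‖ ≤ R := fun j => by
    rw [norm_smul, hnR]
    exact mul_le_of_le_one_right hR.le (norm_truncate_le _)
  have hιb : ∀ j, ‖ι (b j)‖ ≤ S := fun j =>
    (NonUnitalStarAlgHom.norm_apply_le ι (b j)).trans ((hb j).trans hRS)
  have hbx : ∀ j, twoNorm τ (ι (b j) - x j) ≤ δ := by
    intro j
    have h1 : ι (b j) - x j = (R : ℂ) • (truncate (ι (d j)) - truncate (y j)) := by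
      rw [smul_sub, hy, smul_inv_smul₀ hRC, ← map_truncate, ← map_smul]
    have h2 := (hτ'.truncate_sub_le (ι (d j)) (y j)).trans
      (mul_le_mul_of_nonneg_left (hd j).le (by norm_num))
    rw [h1, hτ'.smul, hnR]
    calc R * twoNorm τ (truncate (ι (d j)) - truncate (y j))
        ≤ R * (3 * (δ / (3 * R))) := mul_le_mul_of_nonneg_left h2 hR.le
      _ = δ := by field_simp
  have hword : ∀ w : List (Fin n × Bool), w.length ≤ m →
      ‖τ (ι (starWord b w)) - τ (starWord x w)‖ < ε / 2 := by
    intro w hw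
    have h1 := hτ'.twoNorm_starWord_sub_le hS1 hδ0.le hιb (fun j => (hx j).trans hRS) hbx w
    rw [← map_sub, map_starWord]
    refine ((hτ'.norm_le _).trans h1).trans_lt ?_
    have h2 : (w.length : ℝ) * (S ^ w.length * δ) ≤ m * (S ^ m * δ) := by gcongr
    have h3 : (m : ℝ) * (S ^ m * δ) = ε / 2 * (m / (m + 1)) := by
      rw [hδ]; field_simp
    have h4 : (m : ℝ) / (m + 1) < 1 := by rw [div_lt_one (by positivity)]; linarith
    nlinarith
  -- Represent that subalgebra on `ℂ^k`, almost preserving the trace.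
  obtain ⟨π, hπ⟩ := exists_representations (hτ'.comp ι)
  have hfin : {w : List (Fin n × Bool) | w.length ≤ m}.Finite := List.finite_length_le _ _
  have hev : ∀ᶠ k in atTop, ∀ w ∈ {w : List (Fin n × Bool) | w.length ≤ m},
      ‖matTrace k (π k (starWord b w)) - τ (ι (starWord b w))‖ < ε / 2 := by
    refine (eventually_all_finite hfin).2 fun w _ => ?_
    filter_upwards [Metric.tendsto_nhds.1 (hπ (starWord b w)) (ε / 2) (half_pos hε)] with k hk
    rw [dist_eq_norm] at hk
    exact hk
  filter_upwards [hev] with k hk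
  refine ⟨fun j => π k (b j), fun j => (NonUnitalStarAlgHom.norm_apply_le (π k) (b j)).trans (hb j),
    fun w hw1 hwm => ?_⟩
  have hw0 : w ≠ [] := by rintro rfl; simp at hw1
  have h1 := hk w hwm
  rw [map_starWord_of_ne_nil (π k) b hw0] at h1
  have h2 := norm_add_le (matTrace k (starWord (fun j => π k (b j)) w) - τ (ι (starWord b w)))
    (τ (ι (starWord b w)) - τ (starWord x w))
  rw [sub_add_sub_cancel] at h2
  rw [← matTrace_apply]
  linarith [hword w hwm]

end Existence

/-! ### Covering numbers -/

lemma orbitCoveringNumber_le_one {n k : ℕ} {Γ : Set (Fin n → Matrix (Fin k) (Fin k) ℂ)} {ω : ℝ}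
    (h : ∀ A ∈ Γ, ∀ B ∈ Γ, A ∈ orbitBall B ω) : orbitCoveringNumber Γ ω ≤ 1 := by
  rcases Γ.eq_empty_or_nonempty with rfl | ⟨B, hB⟩
  · exact (iInf_le_of_le ∅ (iInf₂_le_of_le le_rfl (Set.empty_subset _) le_rfl)).trans (by simp)
  · refine (iInf_le_of_le {B} (iInf₂_le_of_le (Set.singleton_subset_iff.2 hB) (fun A hA => ?_)
      le_rfl)).trans (by simp)
    simpa using h A hA B hB

lemma one_le_orbitCoveringNumber {n k : ℕ} {Γ : Set (Fin n → Matrix (Fin k) (Fin k) ℂ)} {ω : ℝ}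
    (h : Γ.Nonempty) : 1 ≤ orbitCoveringNumber Γ ω := by
  refine le_iInf fun C => le_iInf₂ fun _ hC => Set.one_le_encard_iff_nonempty.2 ?_
  obtain ⟨A, hA⟩ := h
  obtain ⟨B, hB, -⟩ := Set.mem_iUnion₂.1 (hC hA)
  exact ⟨B, hB⟩

section OrbitDimension

variable {H : Type*} [NormedAddCommGroup H] [InnerProductSpace ℂ H] [CompleteSpace H]
  {M : VonNeumannAlgebra H} {τ : M.toStarSubalgebra →ₗ[ℂ] ℂ}

lemma microstates_subset {n : ℕ} (x : Fin n → M.toStarSubalgebra) (R : ℝ) {m m₀ : ℕ} (k : ℕ)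
    {ε ε₀ : ℝ} (hm : m₀ ≤ m) (hε : ε ≤ ε₀) : microstates τ x R m k ε ⊆ microstates τ x R m₀ k ε₀ :=
  fun _ hA => ⟨hA.1, fun w h1 h2 => (hA.2 w h1 (h2.trans hm)).trans_le hε⟩

lemma neg_sq_mul_log_nonneg (k : ℕ) {ω : ℝ} (hω : ω ∈ Set.Ioo (0 : ℝ) 1) :
    (0 : EReal) ≤ ((-(k : ℝ) ^ 2 * Real.log ω : ℝ) : EReal) := by
  have h1 := Real.log_neg hω.1 hω.2
  have h2 : (0 : ℝ) ≤ -(k : ℝ) ^ 2 * Real.log ω := by nlinarith [sq_nonneg (k : ℝ)]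
  exact_mod_cast h2

lemma orbitDimAtR_nonpos {n : ℕ} {x : Fin n → M.toStarSubalgebra} {R ω : ℝ}
    (hω : ω ∈ Set.Ioo (0 : ℝ) 1) {m : ℕ} {ε : ℝ} (hε : 0 < ε)
    (h : ∀ k, 1 ≤ k → orbitCoveringNumber (microstates τ x R m k ε) ω ≤ 1) :
    orbitDimAtR τ x ω R ≤ 0 := by
  refine iInf_le_of_le m (iInf₂_le_of_le ε hε (limsup_le_of_le (by isBoundedDefault) ?_))
  filter_upwards [eventually_ge_atTop 1] with k hk
  refine EReal.div_nonpos_of_nonpos_of_nonneg ?_ (neg_sq_mul_log_nonneg k hω)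
  rw [← ENNReal.log_one]
  exact ENNReal.log_monotone (by exact_mod_cast h k hk)

lemma orbitDimAtR_nonneg {n : ℕ} {x : Fin n → M.toStarSubalgebra} {R ω : ℝ}
    (hω : ω ∈ Set.Ioo (0 : ℝ) 1)
    (h : ∀ m ε, 0 < ε → ∀ᶠ k : ℕ in atTop, (microstates τ x R m k ε).Nonempty) :
    0 ≤ orbitDimAtR τ x ω R := by
  refine le_iInf fun m => le_iInf₂ fun ε hε => le_limsup_of_frequently_le ?_ (by isBoundedDefault)
  refine (Eventually.mono (h m ε hε) fun k hk => ?_).frequently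
  refine EReal.div_nonneg ?_ (neg_sq_mul_log_nonneg k hω)
  rw [← ENNReal.log_one]
  exact ENNReal.log_monotone (by exact_mod_cast one_le_orbitCoveringNumber hk)

lemma upperOrbitDim_eq_zero (hτ : IsNormalTracialState M τ) (hfg : IsFinitelyGenerated M)
    (hM : IsHyperfinite M) : upperOrbitDim M τ = 0 := by
  refine le_antisymm ?_ ?_
  · refine iSup_le fun n => iSup₂_le fun x hx => iSup₂_le fun ω hω => iSup₂_le fun R _ => ?_
    obtain ⟨m, ε, hε, h⟩ := exists_forall_mem_orbitBall hτ hM hx R hω.1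
    exact orbitDimAtR_nonpos hω hε fun k hk => orbitCoveringNumber_le_one (h k hk)
  · obtain ⟨n, x, hx⟩ := hfg
    have hω : (1 / 2 : ℝ) ∈ Set.Ioo (0 : ℝ) 1 := by norm_num
    have hR : 0 < ∑ j, ‖x j‖ + 1 := by positivity
    have hxR : ∀ j, ‖x j‖ ≤ ∑ j, ‖x j‖ + 1 := fun j =>
      (Finset.single_le_sum (f := fun j => ‖x j‖) (fun _ _ => norm_nonneg _)
        (Finset.mem_univ j)).trans (by linarith)
    exact le_iSup_of_le n (le_iSup₂_of_le x hx (le_iSup₂_of_le _ hω (le_iSup₂_of_le _ hR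
      (orbitDimAtR_nonneg hω fun m ε hε => eventually_nonempty_microstates hτ hM hR hxR m hε))))

end OrbitDimension

end FreeOrbit

end

theorem theorem2 {H : Type*} [NormedAddCommGroup H] [InnerProductSpace ℂ H] [CompleteSpace H]
    (M : VonNeumannAlgebra H) (τ : M.toStarSubalgebra →ₗ[ℂ] ℂ)
    (hτ : FreeOrbit.IsNormalTracialState M τ)
    (hfg : FreeOrbit.IsFinitelyGenerated M)
    (hhyp : FreeOrbit.IsHyperfinite M) :
    FreeOrbit.upperOrbitDim M τ = 0 ∧
    ∀ (n : ℕ) (x : Fin n → M.toStarSubalgebra), FreeOrbit.Generates M x →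
      ∀ R : ℝ, 0 < R → ∀ ω : ℝ, 0 < ω →
        ∃ (m₀ : ℕ) (ε₀ : ℝ), 0 < ε₀ ∧ ∀ m : ℕ, m₀ ≤ m → ∀ ε : ℝ, 0 < ε → ε ≤ ε₀ →
          (∀ k : ℕ, 1 ≤ k →
            FreeOrbit.orbitCoveringNumber (FreeOrbit.microstates τ x R m k ε) ω ≤ 1) ∧
          ((∀ j, ‖x j‖ < R) → ∀ᶠ k : ℕ in Filter.atTop,
            FreeOrbit.orbitCoveringNumber (FreeOrbit.microstates τ x R m k ε) ω = 1) := by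
  refine ⟨FreeOrbit.upperOrbitDim_eq_zero hτ hfg hhyp, fun n x hx R hR ω hω => ?_⟩
  obtain ⟨m₀, ε₀, hε₀, h⟩ := FreeOrbit.exists_forall_mem_orbitBall hτ hhyp hx R hω
  refine ⟨m₀, ε₀, hε₀, fun m hm ε hε hεε₀ => ?_⟩
  have hle : ∀ k : ℕ, 1 ≤ k →
      FreeOrbit.orbitCoveringNumber (FreeOrbit.microstates τ x R m k ε) ω ≤ 1 := fun k hk =>
    FreeOrbit.orbitCoveringNumber_le_one fun A hA B hB =>
      h k hk A (FreeOrbit.microstates_subset x R k hm hεε₀ hA) B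
        (FreeOrbit.microstates_subset x R k hm hεε₀ hB)
  refine ⟨hle, fun hxR => ?_⟩
  filter_upwards [Filter.eventually_ge_atTop 1,
    FreeOrbit.eventually_nonempty_microstates hτ hhyp hR (fun j => (hxR j).le) m hε] with k hk hne
  exact le_antisymm (hle k hk) (FreeOrbit.one_le_orbitCoveringNumber hne)
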